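/- Let $\pi/3\le a_1<2\pi/5<a_2<\pi$ and $2a_1+a_2/2\ge\pi$. For $i=1,2$ let $\mathcal{P}_i$ be the set of matrix functions $\begin{pmatrix} r_1 & r_2\\ r_2 & -r_1\end{pmatrix}$ on $(0,\pi)$ with complex-valued $r_1,r_2\in L^2[0,\pi]$ that vanish almost everywhere on $(0,a_i)$. For $P\in\mathcal{P}_1$, $Q\in\mathcal{P}_2$, $m\in\{0,1\}$ and $j\in\{1,2\}$ let $D_j(P,Q,m)$ be the boundary value problem $$BY'(x)+(-1)^mP(x)Y(x-a_1)+Q(x)Y(x-a_2)=\lambda Y(x),\quad x\in(0,\pi),\qquad y_1(0)=y_j(\pi)=0,$$ where $B=\begin{pmatrix}0&1\\-1&0\end{pmatrix}$, $Y=(y_1,y_2)^T$ is absolutely continuous on $[0,\pi]$ and the equation holds almost everywhere (the term with $P$ is $0$ for $x<a_1$ and the term with $Q$ is $0$ for $x<a_2$). A number $\lambda\in\mathbb{C}$ is an eigenvalue if there is a solution $Y\not\equiv 0$. Its multiplicity is its order as a zero of the entire function $\Delta_j^m(\lambda)=y_j(\pi)$, where now $Y$ is the solution of the equation with $Y(0)=(0,-1)^T$.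 The spectrum of $D_j(P,Q,m)$ is the family of all its eigenvalues, each repeated according to its multiplicity. Then the four spectra of $D_j(P,Q,m)$, $m\in\{0,1\}$, $j\in\{1,2\}$, determine $P$ on $(a_1,\pi)$ and $Q$ on $(a_2,\pi)$ uniquely: if $P,\tilde P\in\mathcal{P}_1$ and $Q,\tilde Q\in\mathcal{P}_2$ are such that, for all $m\in\{0,1\}$ and $j\in\{1,2\}$, the spectra of $D_j(P,Q,m)$ and $D_j(\tilde P,\tilde Q,m)$ coincide with multiplicities, then $P=\tilde P$ almost everywhere on $(a_1,\pi)$ and $Q=\tilde Q$ almost everywhere on $(a_2,\pi)$. -/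

import Mathlib

open Real MeasureTheory Set Matrix

namespace DiracDelay

/-- The constant matrix `B` of the Dirac system. -/
def matB : Matrix (Fin 2) (Fin 2) ℂ := !![0, 1; -1, 0]

/-- The admissible matrix potentials for a delay `a`: on `(0, π)` the matrix function `P` has the
form `[p₁, p₂; p₂, -p₁]` with complex-valued `p₁, p₂ ∈ L²[0, π]`, and `P = 0` on `(0, a)`
(almost everywhere, potentials being classes of `L²` functions). -/
def IsPotential (a : ℝ) (P : ℝ → Matrix (Fin 2) (Fin 2) ℂ) : Prop :=
  (∃ p₁ p₂ : ℝ → ℂ,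
    MemLp p₁ 2 (volume.restrict (Icc 0 π)) ∧ MemLp p₂ 2 (volume.restrict (Icc 0 π)) ∧
      ∀ x ∈ Ioo 0 π, P x = !![p₁ x, p₂ x; p₂ x, -p₁ x]) ∧
  ∀ᵐ x ∂(volume.restrict (Ioo 0 a)), P x = 0

/-- `Y` is a solution on `[0, π]` of the system
`B Y'(x) + (-1)^m P(x) Y(x - a₁) + Q(x) Y(x - a₂) = z Y(x)`:
it is absolutely continuous and satisfies the equation almost everywhere. For potentials as in
`IsPotential`, the values of `Y` outside `[0, π]` are multiplied by `0` and play no role. -/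
def IsSolution (a₁ a₂ : ℝ) (P Q : ℝ → Matrix (Fin 2) (Fin 2) ℂ) (m : Fin 2) (z : ℂ)
    (Y : ℝ → Fin 2 → ℂ) : Prop :=
  (∀ i, AbsolutelyContinuousOnInterval (fun x => Y x i) 0 π) ∧
  ∀ᵐ x ∂(volume.restrict (Ioo 0 π)), ∃ D : Fin 2 → ℂ, HasDerivAt Y D x ∧
    matB *ᵥ D + (-1 : ℂ) ^ (m : ℕ) • (P x *ᵥ Y (x - a₁)) + Q x *ᵥ Y (x - a₂) = z • Y x

/-- `z` is an eigenvalue of the boundary value problem given by the system and the conditions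
`y₁(0) = 0 = yⱼ(π)`. The two components `y₁, y₂` of `Y` are indexed by `0, 1 : Fin 2`. -/
def IsEigenvalue (a₁ a₂ : ℝ) (P Q : ℝ → Matrix (Fin 2) (Fin 2) ℂ) (m j : Fin 2) (z : ℂ) : Prop :=
  ∃ Y : ℝ → Fin 2 → ℂ, IsSolution a₁ a₂ P Q m z Y ∧ (∃ x ∈ Icc 0 π, Y x ≠ 0) ∧
    Y 0 0 = 0 ∧ Y π j = 0

open Classical in
/-- The fundamental solution: the solution `Y` with `Y(0) = (0, -1)`. For admissible potentials and
positive delays it exists and is unique on `[0, π]`. -/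
noncomputable def fundSol (a₁ a₂ : ℝ) (P Q : ℝ → Matrix (Fin 2) (Fin 2) ℂ) (m : Fin 2) (z : ℂ) :
    ℝ → Fin 2 → ℂ :=
  if h : ∃ Y : ℝ → Fin 2 → ℂ, IsSolution a₁ a₂ P Q m z Y ∧ Y 0 = ![0, -1] then h.choose else 0

/-- The characteristic function: the `j`-th component of the fundamental solution at `π`, as a
function of the spectral parameter `z`. -/
noncomputable def charDelta (a₁ a₂ : ℝ) (P Q : ℝ → Matrix (Fin 2) (Fin 2) ℂ) (m j : Fin 2) (z : ℂ) :
    ℂ :=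
  fundSol a₁ a₂ P Q m z π j

open Classical in
/-- The spectrum of the boundary value problem, as a multiset of complex numbers: it assigns to `z`
its algebraic multiplicity as an eigenvalue, that is, its order as a zero of the entire
characteristic function, and `0` if `z` is not an eigenvalue. -/
noncomputable def spectrumMult (a₁ a₂ : ℝ) (P Q : ℝ → Matrix (Fin 2) (Fin 2) ℂ) (m j : Fin 2)
    (z : ℂ) : ℕ∞ :=
  if IsEigenvalue a₁ a₂ P Q m j z then analyticOrderAt (charDelta a₁ a₂ P Q m j) z else 0

end DiracDelay

namespace DiracDelay

open Filter Topology

/-! ### Entire functions with the same zeros -/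

/-! In the coordinates U = y₁ + i y₂, V = y₁ - i y₂ the system becomes two scalar equations in which
U is driven only by delayed values of V and V only by delayed values of U. Write p = p₁ + i p₂ and q
= p₁ - i p₂ for the coefficients of P, and r, s for those of Q; put a = a₁, b = a₂. Since 3a ≥ π,
three delays do not fit into [0, π], so the third Picard iterate is an exact solution
(`isSolution_iterSol`), and U(π), V(π) are a pure exponential plus terms linear and quadratic in the
coefficients.

Sorting the quadratic terms by lag turns them into correlations. All corrections to U(π) are then
Fourier transforms of two kernels (`delayIter_three_fst`): one collects the terms odd in P (p, and
the products ps, rq), the other the even terms (r, pq, rs). V(π) is the same with (p, r) and (q, s)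
exchanged and z replaced by -z.

A characteristic function is a sine plus an error of smaller order than exp(π|Im z|), so its zeros
determine it completely, constant factor included (`eq_of_analyticOrderAt_eq`). The two values of j
separate U(π) from V(π), the two signs (-1)^m separate odd from even terms, and completeness of the
exponentials on (0, 2π) returns the kernels (`kernel_ae_eq`).

The nonlinear kernels are inverted triangularly (`coef_ae_eq_of_kernel_ae_eq`). The odd kernel is a
multiple of p or q off (a + b/2, π - b/2). As 2a + b/2 ≥ π, these known parts suffice to compute the
correlation of p and q, which gives r and s off (3b/2, π - b/2). As b ≥ 2π/5, that suffices for the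
correlation of r and s, hence for all of r and s, and finally for p and q. -/

lemma exists_entire_quotient {F G : ℂ → ℂ} (hF : Differentiable ℂ F) (hG : Differentiable ℂ G)
    (hord : ∀ z, analyticOrderAt F z = analyticOrderAt G z)
    (hfin : ∀ z, analyticOrderAt G z ≠ ⊤) :
    ∃ h : ℂ → ℂ, Differentiable ℂ h ∧ ∀ z, F z = h z * G z := by
  have hFa : ∀ z, AnalyticAt ℂ F z := fun z => hF.analyticAt z
  have hGa : ∀ z, AnalyticAt ℂ G z := fun z => hG.analyticAt z
  have hmer : MeromorphicOn (F * G⁻¹) univ := fun z _ =>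
    (hFa z).meromorphicAt.mul (hGa z).meromorphicAt.inv
  have han : ∀ z, AnalyticAt ℂ (toMeromorphicNFOn (F * G⁻¹) univ) z := by
    intro z
    have h1 := meromorphicNFOn_toMeromorphicNFOn (F * G⁻¹) univ (mem_univ z)
    -- The order of the quotient is ord F - ord G = 0 at every point, so its normal form has no
    -- poles.
    rw [← h1.meromorphicOrderAt_nonneg_iff_analyticAt,
      meromorphicOrderAt_congr (hmer.toMeromorphicNFOn_eq_self_on_nhdsNE (mem_univ z)),
      meromorphicOrderAt_mul (hFa z).meromorphicAt (hGa z).meromorphicAt.inv,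
      meromorphicOrderAt_inv, (hFa z).meromorphicOrderAt_eq, (hGa z).meromorphicOrderAt_eq, hord z]
    obtain ⟨n, hn⟩ := ENat.ne_top_iff_exists.1 (hfin z)
    rw [← hn]
    simp only [ENat.map_natCast]
    rw [← WithTop.LinearOrderedAddCommGroup.coe_neg, ← WithTop.coe_add]
    simp
  refine ⟨_, fun z => (han z).differentiableAt, fun z => ?_⟩
  have hne : ∀ᶠ w in 𝓝[≠] z, G w ≠ 0 := by
    rcases (hGa z).eventually_eq_zero_or_eventually_ne_zero with h | h
    · exact absurd (analyticOrderAt_eq_top.2 h) (hfin z)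
    · exact h
  have hev : F =ᶠ[𝓝[≠] z] fun w => toMeromorphicNFOn (F * G⁻¹) univ w * G w := by
    filter_upwards [hmer.toMeromorphicNFOn_eq_self_on_nhdsNE (mem_univ z), hne] with w h1 h2
    rw [h1]
    simp [h2]
  exact (((hFa z).continuousAt.eventuallyEq_nhds_iff_eventuallyEq_nhdsNE
    ((han z).continuousAt.mul (hGa z).continuousAt)).1 hev).eq_of_nhds

/-! ### Size of the sine on the boundaries of large squares. -/

lemma norm_sin_sq (z : ℂ) :
    ‖Complex.sin z‖ ^ 2 = Real.sin z.re ^ 2 + Real.sinh z.im ^ 2 := by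
  have h : Complex.sin z = ⟨Real.sin z.re * Real.cosh z.im, Real.cos z.re * Real.sinh z.im⟩ := by
    rw [Complex.sin_eq]
    apply Complex.ext <;>
    simp [← Complex.ofReal_sin, ← Complex.ofReal_cos, ← Complex.ofReal_sinh,
      ← Complex.ofReal_cosh]
  rw [h, ← Complex.normSq_eq_norm_sq, Complex.normSq_mk]
  have h1 := Real.cosh_sq z.im
  have h2 := Real.sin_sq_add_cos_sq z.re
  nlinarith

lemma sinh_sq_eq_exp_abs (y : ℝ) :
    Real.sinh y ^ 2 = ((Real.exp |y| - Real.exp (-|y|)) / 2) ^ 2 := by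
  rw [← Real.sinh_eq]
  rcases abs_cases y with ⟨h, _⟩ | ⟨h, _⟩ <;> rw [h]
  rw [Real.sinh_neg, neg_sq]

lemma norm_sin_le (z : ℂ) : ‖Complex.sin z‖ ≤ Real.exp |z.im| := by
  refine le_of_sq_le_sq ?_ (by positivity)
  rw [norm_sin_sq, sinh_sq_eq_exp_abs]
  have h1 : Real.exp |z.im| * Real.exp (-|z.im|) = 1 := by rw [← Real.exp_add]; simp
  have h2 : 1 ≤ Real.exp |z.im| := Real.one_le_exp (abs_nonneg _)
  have h3 : Real.exp (-|z.im|) ≤ 1 := Real.exp_le_one_iff.2 (by simp)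
  have h4 := Real.sin_sq_le_one z.re
  have h5 := Real.exp_pos (-|z.im|)
  nlinarith

lemma le_norm_sin_of_sin_re_sq {z : ℂ} (h : Real.sin z.re ^ 2 = 1) :
    Real.exp |z.im| / 4 ≤ ‖Complex.sin z‖ := by
  refine le_of_sq_le_sq ?_ (norm_nonneg _)
  rw [norm_sin_sq, sinh_sq_eq_exp_abs, h]
  have h1 : Real.exp |z.im| * Real.exp (-|z.im|) = 1 := by rw [← Real.exp_add]; simp
  nlinarith [sq_nonneg (Real.exp |z.im|), sq_nonneg (Real.exp (-|z.im|))]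

lemma le_norm_sin_of_one_le_im {z : ℂ} (h : 1 ≤ |z.im|) :
    Real.exp |z.im| / 4 ≤ ‖Complex.sin z‖ := by
  refine le_of_sq_le_sq ?_ (norm_nonneg _)
  rw [norm_sin_sq, sinh_sq_eq_exp_abs]
  have h2 : 2 ≤ Real.exp |z.im| := by linarith [Real.add_one_le_exp |z.im|]
  have h3 : Real.exp (-|z.im|) ≤ 1 := Real.exp_le_one_iff.2 (by simp)
  have h5 := Real.exp_pos (-|z.im|)
  have h6 := sq_nonneg (Real.sin z.re)
  have h7 : Real.exp |z.im| / 4 ≤ (Real.exp |z.im| - Real.exp (-|z.im|)) / 2 := by linarith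
  nlinarith

/-- On the vertical sides π Re w is an odd multiple of π/2, so the real sine has modulus 1; on the
horizontal sides the imaginary part is large. These squares stay away from the zeros of the sine. -/
lemma le_norm_sin_pi_mul_of_mem_frontier {N : ℕ} {w : ℂ}
    (hw : |w.re| = N + 1 / 2 ∨ |w.im| = N + 1 / 2) :
    Real.exp (π * |w.im|) / 4 ≤ ‖Complex.sin (π * w)‖ := by
  have him : |(π * w : ℂ).im| = π * |w.im| := by
    simp [abs_mul, abs_of_pos Real.pi_pos]
  rw [← him]
  rcases hw with h | h
  · apply le_norm_sin_of_sin_re_sq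
    have hre : (π * w : ℂ).re = π * w.re := by simp
    rw [hre]
    have key : Real.sin (π * (N + 1 / 2)) ^ 2 = 1 := by
      rw [show π * ((N : ℝ) + 1 / 2) = N * π + π / 2 by ring, Real.sin_add_pi_div_two,
        Real.cos_nat_mul_pi, ← pow_mul, mul_comm, pow_mul]
      simp
    rcases abs_cases w.re with ⟨h', _⟩ | ⟨h', _⟩
    · rw [← h', h, key]
    · rw [show w.re = -(N + 1 / 2) by linarith, mul_neg, Real.sin_neg, neg_sq, key]
  · apply le_norm_sin_of_one_le_im
    rw [him, h]
    have := Real.pi_gt_three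
    have : (0 : ℝ) ≤ N := by positivity
    nlinarith

/-- Two sine type functions with the same zeros (with multiplicities) coincide. -/
theorem eq_of_analyticOrderAt_eq {F G : ℂ → ℂ} (θ : ℝ)
    (hF : Differentiable ℂ F) (hG : Differentiable ℂ G)
    (hFs : Tendsto (fun z : ℂ => ‖F z - Complex.sin (π * (z - θ))‖ * Real.exp (-(π * |z.im|)))
      (cocompact ℂ) (𝓝 0))
    (hGs : Tendsto (fun z : ℂ => ‖G z - Complex.sin (π * (z - θ))‖ * Real.exp (-(π * |z.im|)))
      (cocompact ℂ) (𝓝 0))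
    (hord : ∀ z, analyticOrderAt F z = analyticOrderAt G z) : F = G := by
  have small : ∀ {H : ℂ → ℂ}, Tendsto (fun z : ℂ => ‖H z - Complex.sin (π * (z - θ))‖ *
      Real.exp (-(π * |z.im|))) (cocompact ℂ) (𝓝 0) → ∀ ε > 0, ∃ R : ℝ, ∀ z : ℂ, R < ‖z‖ →
      ‖H z - Complex.sin (π * (z - θ))‖ ≤ ε * Real.exp (π * |z.im|) := by
    intro H hH ε hε
    have h1 := hH.eventually (gt_mem_nhds hε)
    rw [← Metric.cobounded_eq_cocompact, hasBasis_cobounded_norm.eventually_iff] at h1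
    obtain ⟨R, -, hR⟩ := h1
    refine ⟨R, fun z hz => ?_⟩
    have h2 := (hR (show z ∈ {x : ℂ | R ≤ ‖x‖} from hz.le)).le
    rw [Real.exp_neg, ← div_eq_mul_inv, div_le_iff₀ (Real.exp_pos _)] at h2
    exact h2
  have him : ∀ z : ℂ, (z - θ : ℂ).im = z.im := fun z => by simp
  -- 1/8 is half of the constant 1/4 in the lower bound for the sine. Hence |G| ≥ exp(π|Im z|)/8 on
  -- the squares, and with |F| ≤ 2 exp(π|Im z|) the quotient is at most 16 there.
  obtain ⟨R₁, hR₁⟩ := small hFs (1 / 8) (by norm_num)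
  obtain ⟨R₂, hR₂⟩ := small hGs (1 / 8) (by norm_num)
  have bdF : ∀ z : ℂ, R₁ < ‖z‖ → ‖F z‖ ≤ 2 * Real.exp (π * |z.im|) := by
    intro z hz
    have h1 := norm_sin_le (π * (z - θ))
    have h2 : |(π * (z - θ) : ℂ).im| = π * |z.im| := by
      simp [abs_mul, abs_of_pos Real.pi_pos]
    rw [h2] at h1
    have h3 := norm_add_le (F z - Complex.sin (π * (z - θ))) (Complex.sin (π * (z - θ)))
    rw [sub_add_cancel] at h3
    have := hR₁ z hz
    have := Real.exp_pos (π * |z.im|)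
    linarith
  have bdG : ∀ (N : ℕ) (z : ℂ), R₂ < ‖z‖ →
      (|(z - θ : ℂ).re| = N + 1 / 2 ∨ |(z - θ : ℂ).im| = N + 1 / 2) →
      Real.exp (π * |z.im|) / 8 ≤ ‖G z‖ := by
    intro N z hz hN
    have h1 := le_norm_sin_pi_mul_of_mem_frontier hN
    rw [him] at h1
    have h3 := norm_sub_le (G z) (G z - Complex.sin (π * (z - θ)))
    rw [sub_sub_cancel] at h3
    have := hR₂ z hz
    linarith
  have hnorm : ∀ (R : ℝ) (N : ℕ), R + |θ| < N → ∀ z : ℂ,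
      (|(z - θ : ℂ).re| = N + 1 / 2 ∨ |(z - θ : ℂ).im| = N + 1 / 2) → R < ‖z‖ := by
    intro R N hRN z hz
    have h1 : (N : ℝ) + 1 / 2 ≤ ‖z - θ‖ := by
      rcases hz with h | h
      · rw [← h]; exact Complex.abs_re_le_norm _
      · rw [← h]; exact Complex.abs_im_le_norm _
    have h2 := norm_sub_le z (θ : ℂ)
    rw [Complex.norm_real, Real.norm_eq_abs] at h2
    linarith
  have hfin : ∀ z, analyticOrderAt G z ≠ ⊤ := by
    intro z hz
    have h0 : EqOn G 0 univ :=
      AnalyticOnNhd.eqOn_zero_of_preconnected_of_eventuallyEq_zero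
        (fun w _ => hG.analyticAt w) isPreconnected_univ (mem_univ z) (analyticOrderAt_eq_top.1 hz)
    obtain ⟨N, hN⟩ := exists_nat_gt (R₂ + |θ|)
    have hz : |((θ + (N + 1 / 2 : ℝ) * Complex.I : ℂ) - θ : ℂ).im| = N + 1 / 2 := by
      rw [add_sub_cancel_left]
      simp only [Complex.mul_im, Complex.ofReal_re, Complex.I_im, Complex.ofReal_im,
        Complex.I_re, mul_one, mul_zero, add_zero]
      exact abs_of_pos (by positivity)
    have h1 := bdG N _ (hnorm R₂ N hN _ (Or.inr hz)) (Or.inr hz)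
    rw [h0 (mem_univ _)] at h1
    have := Real.exp_pos (π * |(θ + (N + 1 / 2 : ℝ) * Complex.I : ℂ).im|)
    simp only [Pi.zero_apply, norm_zero] at h1
    linarith
  obtain ⟨h, hh, hFG⟩ := exists_entire_quotient hF hG hord hfin
  -- The bound passes from the boundaries of squares centred at θ to their interiors by the maximum
  -- principle; Liouville then makes the quotient constant.
  have hbd : ∀ z, ‖h z‖ ≤ 16 := by
    intro z
    obtain ⟨N, hN⟩ := exists_nat_gt (max (max R₁ R₂ + |θ|) ‖z - θ‖)
    have hN1 := (le_max_left _ _).trans_lt hN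
    have hN2 := (le_max_right _ _).trans_lt hN
    set L : ℝ := N + 1 / 2 with hL
    have hLpos : 0 < L := by positivity
    have hmem : z ∈ closure (Ioo (θ - L) (θ + L) ×ℂ Ioo (-L) L) := by
      apply subset_closure
      have h1 := (Complex.abs_re_le_norm (z - θ)).trans_lt hN2
      have h2 := (Complex.abs_im_le_norm (z - θ)).trans_lt hN2
      rw [abs_lt] at h1 h2
      simp only [Complex.sub_re, Complex.ofReal_re, Complex.sub_im, Complex.ofReal_im] at h1 h2
      rw [Complex.mem_reProdIm]
      constructor <;> constructor <;> linarith
    refine Complex.norm_le_of_forall_mem_frontier_norm_le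
      (U := Ioo (θ - L) (θ + L) ×ℂ Ioo (-L) L)
      ((Metric.isBounded_Ioo _ _).reProdIm (Metric.isBounded_Ioo _ _)) hh.diffContOnCl ?_ hmem
    intro w hw
    have hw' : |(w - θ : ℂ).re| = N + 1 / 2 ∨ |(w - θ : ℂ).im| = N + 1 / 2 := by
      rw [Complex.frontier_reProdIm, frontier_Ioo (by linarith), frontier_Ioo (by linarith)] at hw
      simp only [Complex.sub_re, Complex.ofReal_re, Complex.sub_im, Complex.ofReal_im, sub_zero]
      rw [← hL]
      rcases hw with hw | hw
      · right
        rcases hw.2 with hw | hw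
        · rw [show w.im = -L from hw, abs_neg, abs_of_pos hLpos]
        · rw [show w.im = L from hw, abs_of_pos hLpos]
      · left
        rcases hw.1 with hw | hw
        · rw [show w.re = θ - L from hw, show θ - L - θ = -L by ring, abs_neg, abs_of_pos hLpos]
        · rw [show w.re = θ + L from hw, show θ + L - θ = L by ring, abs_of_pos hLpos]
    have hw1 := hnorm _ N hN1 w hw'
    have h1 := bdF w ((le_max_left _ _).trans_lt hw1)
    have h2 := bdG N w ((le_max_right _ _).trans_lt hw1) hw'
    rw [hFG w, norm_mul] at h1
    have h3 := Real.exp_pos (π * |w.im|)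
    by_contra hcon
    push Not at hcon
    nlinarith
  obtain ⟨k, hk⟩ := hh.exists_eq_const_of_bounded
    ((Metric.isBounded_closedBall (x := (0 : ℂ)) (r := 16)).subset (by
      rintro _ ⟨z, rfl⟩
      simpa using hbd z))
  have hFG' : ∀ z, F z = k * G z := fun z => by rw [hFG z, hk]; rfl
  -- F and G have the same leading sine. If k ≠ 1, then ε makes the combined error at most ‖k - 1‖/8
  -- times exp(π|Im z|), whereas high above θ the difference of the leading terms is at least ‖k -
  -- 1‖/4 times it.
  suffices hk1 : k = 1 by
    funext z
    rw [hFG', hk1, one_mul]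
  by_contra hne
  have hpos : 0 < ‖k - 1‖ := norm_pos_iff.2 (sub_ne_zero.2 hne)
  set ε : ℝ := ‖k - 1‖ / (8 * (1 + ‖k‖)) with hε
  have hεpos : 0 < ε := by positivity
  obtain ⟨R₃, hR₃⟩ := small hFs ε hεpos
  obtain ⟨R₄, hR₄⟩ := small hGs ε hεpos
  obtain ⟨N, hN⟩ := exists_nat_gt (max R₃ R₄ + |θ|)
  set z : ℂ := θ + (N + 1 / 2 : ℝ) * Complex.I with hzdef
  have hz : |(z - θ : ℂ).im| = N + 1 / 2 := by
    rw [hzdef, add_sub_cancel_left]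
    simp only [Complex.mul_im, Complex.ofReal_re, Complex.I_im, Complex.ofReal_im,
      Complex.I_re, mul_one, mul_zero, add_zero]
    exact abs_of_pos (by positivity)
  have hz1 := hnorm _ N hN z (Or.inr hz)
  have h1 := hR₃ z ((le_max_left _ _).trans_lt hz1)
  have h2 := hR₄ z ((le_max_right _ _).trans_lt hz1)
  have h3 := le_norm_sin_pi_mul_of_mem_frontier (N := N) (w := z - θ) (Or.inr hz)
  rw [him] at h3
  have h4 : (k - 1) * Complex.sin (π * (z - θ)) =
      (F z - Complex.sin (π * (z - θ))) - k * (G z - Complex.sin (π * (z - θ))) := by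
    rw [hFG']; ring
  have h5 := norm_sub_le (F z - Complex.sin (π * (z - θ))) (k * (G z - Complex.sin (π * (z - θ))))
  rw [← h4, norm_mul, norm_mul] at h5
  have h6 := Real.exp_pos (π * |z.im|)
  have h7 : ε * (1 + ‖k‖) = ‖k - 1‖ / 8 := by
    rw [hε]; field_simp
  have h8 : ‖k‖ * ‖G z - Complex.sin (π * (z - θ))‖ ≤ ‖k‖ * (ε * Real.exp (π * |z.im|)) := by
    gcongr
  have h9 : ‖k - 1‖ * (Real.exp (π * |z.im|) / 4) ≤
      ‖k - 1‖ * ‖Complex.sin (π * (z - θ))‖ := by gcongr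
  have h10 : ε * Real.exp (π * |z.im|) + ‖k‖ * (ε * Real.exp (π * |z.im|)) =
      ‖k - 1‖ / 8 * Real.exp (π * |z.im|) := by rw [← h7]; ring
  nlinarith [mul_pos hpos h6]

/-! ### Fourier-Laplace transforms of integrable functions -/

/-- The exponential transform `∫ f(t) exp(iz(c - 2t)) dt`. -/
noncomputable def expTransform (c : ℝ) (f : ℝ → ℂ) (z : ℂ) : ℂ :=
  ∫ t, f t * Complex.exp (Complex.I * z * ((c - 2 * t : ℝ) : ℂ))

lemma norm_exp_I_mul_le {z : ℂ} {x : ℝ} (hx : |x| ≤ π) :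
    ‖Complex.exp (Complex.I * z * (x : ℂ))‖ ≤ Real.exp (π * |z.im|) := by
  rw [Complex.norm_exp]
  apply Real.exp_le_exp.2
  have : (Complex.I * z * (x : ℂ)).re = -(z.im * x) := by simp
  rw [this]
  calc -(z.im * x) ≤ |z.im * x| := neg_le_abs _
    _ = |x| * |z.im| := by rw [abs_mul, mul_comm]
    _ ≤ π * |z.im| := by gcongr

/-- On the support of f the exponential is at most exp(π|Im z|), so the z-derivative of the
integrand is locally dominated by a multiple of |f|. -/
lemma differentiable_expTransform {c : ℝ} {f : ℝ → ℂ} (hf : Integrable f)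
    (hsupp : ∀ t, π < |c - 2 * t| → f t = 0) : Differentiable ℂ (expTransform c f) := by
  intro z₀
  have hmeas : ∀ z : ℂ, AEStronglyMeasurable
      (fun t => f t * Complex.exp (Complex.I * z * ((c - 2 * t : ℝ) : ℂ))) volume := fun z =>
    hf.aestronglyMeasurable.mul (by fun_prop : Continuous fun t : ℝ =>
      Complex.exp (Complex.I * z * ((c - 2 * t : ℝ) : ℂ))).aestronglyMeasurable
  have hbound : ∀ (z : ℂ) (t : ℝ), ‖f t * Complex.exp (Complex.I * z * ((c - 2 * t : ℝ) : ℂ))‖ ≤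
      ‖f t‖ * Real.exp (π * |z.im|) := by
    intro z t
    by_cases ht : π < |c - 2 * t|
    · simp [hsupp t ht]
    · rw [norm_mul]
      gcongr
      exact norm_exp_I_mul_le (not_lt.1 ht)
  refine (hasDerivAt_integral_of_dominated_loc_of_deriv_le (𝕜 := ℂ)
    (F := fun (z : ℂ) (t : ℝ) => f t * Complex.exp (Complex.I * z * ((c - 2 * t : ℝ) : ℂ)))
    (F' := fun (z : ℂ) (t : ℝ) => f t * Complex.exp (Complex.I * z * ((c - 2 * t : ℝ) : ℂ)) *
      (Complex.I * ((c - 2 * t : ℝ) : ℂ)))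
    (bound := fun t => ‖f t‖ * Real.exp (π * (|z₀.im| + 1)) * π)
    (Metric.ball_mem_nhds z₀ one_pos) (Eventually.of_forall hmeas) ?_ ?_ ?_ ?_ ?_).2.differentiableAt
  · exact (hf.norm.mul_const _).mono' (hmeas z₀) (Eventually.of_forall (hbound z₀))
  · exact (hmeas z₀).mul (by fun_prop : Continuous fun t : ℝ =>
      Complex.I * ((c - 2 * t : ℝ) : ℂ)).aestronglyMeasurable
  · refine Eventually.of_forall fun t z hz => ?_
    by_cases ht : π < |c - 2 * t|
    · simp [hsupp t ht]
    · rw [norm_mul _ (Complex.I * _), norm_mul Complex.I, Complex.norm_I, one_mul,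
        Complex.norm_real, Real.norm_eq_abs]
      have h1 : |z.im| ≤ |z₀.im| + 1 := by
        have h2 := Complex.abs_im_le_norm (z - z₀)
        rw [Metric.mem_ball, dist_eq_norm] at hz
        rw [Complex.sub_im] at h2
        have := abs_sub_abs_le_abs_sub z.im z₀.im
        linarith
      have h3 : Real.exp (π * |z.im|) ≤ Real.exp (π * (|z₀.im| + 1)) :=
        Real.exp_le_exp.2 (by gcongr)
      calc _ ≤ ‖f t‖ * Real.exp (π * |z.im|) * π :=
            mul_le_mul (hbound z t) (not_lt.1 ht) (abs_nonneg _) (by positivity)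
        _ ≤ _ := by gcongr
  · exact (hf.norm.mul_const _).mul_const _
  · refine Eventually.of_forall fun t z _ => ?_
    have h1 : HasDerivAt (fun z : ℂ => Complex.I * z * ((c - 2 * t : ℝ) : ℂ))
        (Complex.I * ((c - 2 * t : ℝ) : ℂ)) z := by
      simpa using ((hasDerivAt_id z).const_mul Complex.I).mul_const ((c - 2 * t : ℝ) : ℂ)
    simpa [mul_assoc] using h1.cexp.const_mul (f t)

/-- A Riemann-Lebesgue lemma, uniform in the complex plane. -/
lemma tendsto_expTransform {c : ℝ} {f : ℝ → ℂ} (hf : Integrable f)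
    (hsupp : ∀ t, π < |c - 2 * t| → f t = 0) :
    Tendsto (fun z : ℂ => ‖expTransform c f z‖ * Real.exp (-(π * |z.im|))) (cocompact ℂ) (𝓝 0) := by
  set l : ℝ := (c - π) / 2 with hl
  set u : ℝ := (c + π) / 2 with hu
  have hlu : l ≤ u := by rw [hl, hu]; linarith [Real.pi_pos]
  have habs : ∀ t ∈ Icc l u, |c - 2 * t| ≤ π := by
    intro t ht
    rw [abs_le]
    constructor <;> linarith [ht.1, ht.2]
  have hzero : ∀ t ∉ Icc l u, f t = 0 := by
    intro t ht
    apply hsupp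
    by_contra hcon
    rw [not_lt, abs_le] at hcon
    exact ht ⟨by rw [hl]; linarith [hcon.2], by rw [hu]; linarith [hcon.1]⟩
  rw [Metric.tendsto_nhds]
  intro ε hε
  -- The L¹ error of a smooth approximant costs ε/2 after weighting; integration by parts gains
  -- 1/‖z‖ on g itself. Since g need not vanish at l and u, boundary terms enter K.
  obtain ⟨g, hg₁, hg₂, hg₃⟩ := MemLp.exist_eLpNorm_sub_le (p := 1) ENNReal.one_ne_top le_rfl
    (memLp_one_iff_integrable.2 hf) (half_pos hε)
  have hgint : Integrable g := hg₂.continuous.integrable_of_hasCompactSupport hg₁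
  have hfg : ∫ t, ‖f t - g t‖ ≤ ε / 2 := by
    rw [eLpNorm_one_eq_lintegral_enorm] at hg₃
    have h0 := integral_norm_eq_lintegral_enorm (hf.sub hgint).aestronglyMeasurable
    simp only [Pi.sub_apply] at h0 hg₃
    rw [h0]
    exact ENNReal.toReal_le_of_le_ofReal (by linarith) hg₃
  set K : ℝ := ‖g u‖ + ‖g l‖ + ∫ t in l..u, ‖deriv g t‖ with hK
  have hKnn : 0 ≤ K := by
    have := intervalIntegral.integral_nonneg (μ := volume) (f := fun t => ‖deriv g t‖) hlu
      (fun t _ => norm_nonneg _)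
    positivity
  have hgd : ∀ t, HasDerivAt g (deriv g t) t := fun t =>
    (hg₂.differentiable (by simp) t).hasDerivAt
  have hgdc : Continuous (deriv g) := hg₂.continuous_deriv (by simp)
  have main : ∀ z : ℂ, z ≠ 0 → ‖expTransform c f z‖ * Real.exp (-(π * |z.im|)) ≤
      ε / 2 + K / (2 * ‖z‖) := by
    intro z hz
    set e : ℝ → ℂ := fun t => Complex.exp (Complex.I * z * ((c - 2 * t : ℝ) : ℂ)) with he
    have hec : Continuous e := by rw [he]; fun_prop
    have hele : ∀ t ∈ Icc l u, ‖e t‖ ≤ Real.exp (π * |z.im|) := fun t ht =>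
      norm_exp_I_mul_le (habs t ht)
    have h1 : expTransform c f z = (∫ t in l..u, (f t - g t) * e t) + ∫ t in l..u, g t * e t := by
      rw [← intervalIntegral.integral_add]
      · rw [intervalIntegral.integral_of_le hlu, ← integral_Icc_eq_integral_Ioc, expTransform,
          ← setIntegral_eq_integral_of_forall_compl_eq_zero (s := Icc l u)]
        · refine setIntegral_congr_fun measurableSet_Icc fun t _ => ?_
          simp only [he]; ring
        · intro t ht
          simp [hzero t ht]
      · exact (hf.sub hgint).intervalIntegrable.mul_continuousOn hec.continuousOn
      · exact (hg₂.continuous.mul hec).intervalIntegrable _ _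
    have h2 : ‖∫ t in l..u, (f t - g t) * e t‖ ≤ ε / 2 * Real.exp (π * |z.im|) := by
      have hi : Integrable (fun t => ‖f t - g t‖ * Real.exp (π * |z.im|)) :=
        (hf.sub hgint).norm.mul_const _
      calc ‖∫ t in l..u, (f t - g t) * e t‖
          ≤ ∫ t in l..u, ‖f t - g t‖ * Real.exp (π * |z.im|) := by
            refine intervalIntegral.norm_integral_le_of_norm_le hlu
              (Eventually.of_forall fun t ht => ?_) hi.intervalIntegrable
            rw [norm_mul]
            gcongr
            exact hele t (Ioc_subset_Icc_self ht)
        _ ≤ ∫ t, ‖f t - g t‖ * Real.exp (π * |z.im|) := by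
            rw [intervalIntegral.integral_of_le hlu]
            exact setIntegral_le_integral hi (Eventually.of_forall fun t => by positivity)
        _ ≤ _ := by
            rw [integral_mul_const]
            gcongr
    have hd : ∀ t, HasDerivAt (fun t => e t / (-2 * Complex.I * z)) (e t) t := by
      intro t
      have h3 : HasDerivAt (fun t : ℝ => Complex.I * z * ((c - 2 * t : ℝ) : ℂ))
          (Complex.I * z * ((-2 : ℝ) : ℂ)) t := by
        refine HasDerivAt.const_mul _ ?_
        refine HasDerivAt.ofReal_comp ?_
        simpa using ((hasDerivAt_id t).const_mul (2 : ℝ)).const_sub c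
      refine (h3.cexp.div_const (-2 * Complex.I * z)).congr_deriv ?_
      simp only [he]
      have := Complex.I_ne_zero
      field_simp
      push_cast; ring
    have h4 := intervalIntegral.integral_mul_deriv_eq_deriv_mul (a := l) (b := u)
      (fun t _ => hgd t) (fun t _ => hd t) (hgdc.intervalIntegrable _ _)
      (hec.intervalIntegrable _ _)
    have h5 : ∀ t ∈ Icc l u, ‖e t / (-2 * Complex.I * z)‖ ≤
        Real.exp (π * |z.im|) / (2 * ‖z‖) := by
      intro t ht
      rw [norm_div]
      simp only [norm_mul, norm_neg, Complex.norm_ofNat, Complex.norm_I, mul_one]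
      gcongr
      exact hele t ht
    have h6 : ‖∫ t in l..u, g t * e t‖ ≤ K * (Real.exp (π * |z.im|) / (2 * ‖z‖)) := by
      rw [h4]
      have h7 : ‖∫ t in l..u, deriv g t * (e t / (-2 * Complex.I * z))‖ ≤
          (∫ t in l..u, ‖deriv g t‖) * (Real.exp (π * |z.im|) / (2 * ‖z‖)) := by
        rw [← intervalIntegral.integral_mul_const]
        refine intervalIntegral.norm_integral_le_of_norm_le hlu
          (Eventually.of_forall fun t ht => ?_)
          ((hgdc.norm.mul continuous_const).intervalIntegrable _ _)
        rw [norm_mul]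
        gcongr
        exact h5 t (Ioc_subset_Icc_self ht)
      refine (norm_sub_le _ _).trans ?_
      refine (add_le_add ((norm_sub_le _ _).trans (add_le_add
        ((norm_mul_le _ _).trans (mul_le_mul_of_nonneg_left (h5 u ⟨hlu, le_rfl⟩) (norm_nonneg _)))
        ((norm_mul_le _ _).trans (mul_le_mul_of_nonneg_left (h5 l ⟨le_rfl, hlu⟩)
          (norm_nonneg _))))) h7).trans ?_
      rw [hK]
      apply le_of_eq; ring
    have h8 : ‖expTransform c f z‖ ≤ (ε / 2 + K / (2 * ‖z‖)) * Real.exp (π * |z.im|) := by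
      rw [h1]
      refine (norm_add_le _ _).trans ((add_le_add h2 h6).trans (le_of_eq ?_))
      ring
    rwa [Real.exp_neg, ← div_eq_mul_inv, div_le_iff₀ (Real.exp_pos _)]
  rw [← Metric.cobounded_eq_cocompact, hasBasis_cobounded_norm.eventually_iff]
  refine ⟨(K + 1) / ε, trivial, fun z hz => ?_⟩
  have hz' : (K + 1) / ε ≤ ‖z‖ := hz
  have hzpos : 0 < ‖z‖ := lt_of_lt_of_le (by positivity) hz'
  have h1 := main z (norm_pos_iff.1 hzpos)
  rw [dist_zero_right, Real.norm_of_nonneg (by positivity)]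
  refine h1.trans_lt ?_
  have h2 : K / (2 * ‖z‖) < ε / 2 := by
    rw [div_lt_iff₀ (by positivity)]
    rw [div_le_iff₀ hε] at hz'
    linarith
  linarith

/-! ### Square integrable functions with bounded support -/

/-- `f` is square integrable on the line and vanishes off `(l, u)`. -/
structure IsCoef (l u : ℝ) (f : ℝ → ℂ) : Prop where
  memLp : MemLp f 2 volume
  eq_zero : ∀ t, t ∉ Ioo l u → f t = 0

namespace IsCoef

variable {l u l' u' : ℝ} {f g : ℝ → ℂ}

lemma mono (h : IsCoef l u f) (hl : l' ≤ l) (hu : u ≤ u') : IsCoef l' u' f :=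
  ⟨h.memLp, fun t ht => h.eq_zero t fun h' => ht ⟨hl.trans_lt h'.1, h'.2.trans_le hu⟩⟩

lemma add (hf : IsCoef l u f) (hg : IsCoef l u g) : IsCoef l u (fun t => f t + g t) :=
  ⟨hf.memLp.add hg.memLp, fun t ht => by simp [hf.eq_zero t ht, hg.eq_zero t ht]⟩

lemma sub (hf : IsCoef l u f) (hg : IsCoef l u g) : IsCoef l u (fun t => f t - g t) :=
  ⟨hf.memLp.sub hg.memLp, fun t ht => by simp [hf.eq_zero t ht, hg.eq_zero t ht]⟩

lemma const_mul (hf : IsCoef l u f) (k : ℂ) : IsCoef l u (fun t => k * f t) :=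
  ⟨hf.memLp.const_mul k, fun t ht => by simp [hf.eq_zero t ht]⟩

lemma neg (hf : IsCoef l u f) : IsCoef l u (-f) :=
  ⟨hf.memLp.neg, fun t ht => by simp [hf.eq_zero t ht]⟩

lemma comp_sub_right (hf : IsCoef l u f) (c : ℝ) :
    IsCoef (l + c) (u + c) (fun t => f (t - c)) :=
  ⟨hf.memLp.comp_measurePreserving (measurePreserving_sub_right volume c), fun t ht =>
    hf.eq_zero _ fun h => ht ⟨by linarith [h.1], by linarith [h.2]⟩⟩

lemma integrable (hf : IsCoef l u f) : Integrable f := by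
  have h1 : Integrable f (volume.restrict (Ioo l u)) :=
    memLp_one_iff_integrable.1 ((hf.memLp.restrict (Ioo l u)).mono_exponent (by norm_num))
  exact IntegrableOn.integrable_of_forall_notMem_eq_zero h1 hf.eq_zero

lemma mul_continuous (hf : IsCoef l u f) {e : ℝ → ℂ} (he : Continuous e) :
    Integrable (fun t => f t * e t) := by
  have h1 : IntegrableOn (fun t => f t * e t) (Icc l u) :=
    hf.integrable.integrableOn.mul_continuousOn he.continuousOn isCompact_Icc
  refine h1.integrable_of_forall_notMem_eq_zero fun t ht => ?_
  rw [hf.eq_zero t fun h => ht (Ioo_subset_Icc_self h), zero_mul]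

end IsCoef

/-- A square integrable function supported in `(0, 2π)` is determined by its transform. -/
lemma ae_eq_zero_of_expTransform_eq_zero {c : ℝ} {f : ℝ → ℂ} (hf : IsCoef 0 (2 * π) f)
    (h0 : ∀ z, expTransform c f z = 0) : f =ᵐ[volume] 0 := by
  have hpi : (0 : ℝ) < 2 * π := by positivity
  have hcoef : ∀ n : ℤ, fourierCoeffOn hpi f n = 0 := by
    intro n
    rw [fourierCoeffOn_eq_integral]
    -- At z = n/2 the transform is a nonzero constant times the n-th Fourier integral over (0, 2π);
    -- Parseval then gives f = 0.
    have h1 := h0 (n / 2)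
    rw [expTransform] at h1
    have h2 : (fun t => f t * Complex.exp (Complex.I * (n / 2) * ((c - 2 * t : ℝ) : ℂ))) =
        fun t : ℝ =>
          Complex.exp (Complex.I * (n / 2) * c) * (Complex.exp (-(Complex.I * n * t)) * f t) := by
      funext t
      rw [← mul_assoc, ← Complex.exp_add, mul_comm (f t)]
      congr 2
      push_cast; ring
    rw [h2, integral_const_mul, mul_eq_zero, or_iff_right (Complex.exp_ne_zero _)] at h1
    have h3 : ∫ x in (0 : ℝ)..(2 * π), fourier (-n) (x : AddCircle (2 * π - 0)) • f x =
        ∫ t : ℝ, Complex.exp (-(Complex.I * n * t)) * f t := by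
      have h4 : ∫ t in Ioc (0 : ℝ) (2 * π), Complex.exp (-(Complex.I * n * t)) * f t =
          ∫ t : ℝ, Complex.exp (-(Complex.I * n * t)) * f t :=
        setIntegral_eq_integral_of_forall_compl_eq_zero fun t ht => by
          rw [hf.eq_zero t fun h => ht (Ioo_subset_Ioc_self h), mul_zero]
      rw [intervalIntegral.integral_of_le hpi.le, ← h4]
      refine setIntegral_congr_fun measurableSet_Ioc fun t _ => ?_
      simp only [fourier_coe_apply, smul_eq_mul]
      congr 2
      have : (π : ℂ) ≠ 0 := by exact_mod_cast Real.pi_ne_zero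
      push_cast
      field_simp
      ring
    rw [h3, h1, smul_zero]
  have hsum := tsum_sq_fourierCoeffOn hpi (hf.memLp.restrict (Ioc 0 (2 * π)))
  simp only [hcoef, norm_zero, ne_eq, OfNat.ofNat_ne_zero, not_false_eq_true, zero_pow, tsum_zero,
    sub_zero, smul_eq_mul] at hsum
  have hint : ∫ x in (0 : ℝ)..(2 * π), ‖f x‖ ^ 2 = 0 := by
    rcases mul_eq_zero.1 hsum.symm with h | h
    · exact absurd h (inv_ne_zero hpi.ne')
    · exact h
  rw [intervalIntegral.integral_of_le hpi.le,
    setIntegral_eq_integral_of_forall_compl_eq_zero (fun t ht => by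
      rw [hf.eq_zero t fun h => ht (Ioo_subset_Ioc_self h)]; simp),
    integral_eq_zero_iff_of_nonneg (fun t => by positivity)
      ((memLp_two_iff_integrable_sq_norm hf.memLp.1).1 hf.memLp)] at hint
  filter_upwards [hint] with t ht
  simpa using ht

/-! ### Truncated correlations -/

/-- The correlation `∫ f(s + w) g(s) ds`, truncated to lags `w > a`. -/
noncomputable def corr (a : ℝ) (f g : ℝ → ℂ) (w : ℝ) : ℂ :=
  if a < w then ∫ s, f (s + w) * g s else 0

lemma corr_const_mul_left (a : ℝ) (k : ℂ) (f g : ℝ → ℂ) (w : ℝ) :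
    corr a (fun t => k * f t) g w = k * corr a f g w := by
  unfold corr
  split_ifs
  · rw [← integral_const_mul]; simp only [mul_assoc]
  · simp

lemma corr_const_mul_right (a : ℝ) (k : ℂ) (f g : ℝ → ℂ) (w : ℝ) :
    corr a f (fun t => k * g t) w = k * corr a f g w := by
  unfold corr
  split_ifs
  · rw [← integral_const_mul]; simp only [mul_left_comm]
  · simp

lemma corr_neg_neg (a : ℝ) (f g : ℝ → ℂ) (w : ℝ) : corr a (-f) (-g) w = corr a f g w := by
  simp [corr]

lemma integrable_shear {f g : ℝ → ℂ} (hf : Integrable f) (hg : Integrable g) :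
    Integrable (fun x : ℝ × ℝ => f (x.1 + x.2) * g x.1) (volume.prod volume) := by
  have h1 := (measurePreserving_prod_add volume volume).integrable_comp_of_integrable
    (hg.mul_prod hf)
  refine h1.congr (Eventually.of_forall fun x => ?_)
  simp [mul_comm]

/-- Fubini after the measure-preserving shear (s, w) ↦ (s, s + w), which turns the truncation w > a
into s < t - a. -/
lemma integral_corr (a : ℝ) {f g : ℝ → ℂ} (hf : Integrable f) (hg : Integrable g) :
    ∫ w, corr a f g w = ∫ t, f t * ∫ s in Iio (t - a), g s := by
  set K : ℝ × ℝ → ℂ := {x : ℝ × ℝ | x.1 < x.2 - a}.indicator (fun x => f x.2 * g x.1) with hK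
  have hset : MeasurableSet {x : ℝ × ℝ | x.1 < x.2 - a} :=
    measurableSet_lt measurable_fst (measurable_snd.sub_const a)
  have hKint : Integrable K (volume.prod volume) := by
    refine Integrable.indicator ?_ hset
    refine (hg.mul_prod hf).congr (Eventually.of_forall fun x => ?_)
    simp [mul_comm]
  have hmp := measurePreserving_prod_add (volume : Measure ℝ) (volume : Measure ℝ)
  have hKsint : Integrable (fun x : ℝ × ℝ => K (x.1, x.1 + x.2)) (volume.prod volume) :=
    hmp.integrable_comp_of_integrable hKint
  have h1 : ∫ x, K (x.1, x.1 + x.2) ∂(volume.prod volume) = ∫ x, K x ∂(volume.prod volume) :=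
    hmp.integral_comp (MeasurableEquiv.shearAddRight ℝ).measurableEmbedding K
  rw [integral_prod_symm _ hKint, integral_prod_symm _ hKsint] at h1
  convert h1 using 1
  · congr 1
    funext w
    unfold corr
    split_ifs with hw
    · congr 1
      funext s
      rw [hK, indicator_of_mem]
      simp only [mem_ofPred_eq]; linarith
    · symm
      convert integral_zero ℝ ℂ with s
      rw [hK, indicator_of_notMem]
      simp only [mem_ofPred_eq]; linarith
  · congr 1
    funext t
    rw [← integral_const_mul, ← integral_indicator measurableSet_Iio]
    rfl

lemma norm_integral_shear_le {f g : ℝ → ℂ} (hf : MemLp f 2 volume) (hg : MemLp g 2 volume)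
    (w : ℝ) : ‖∫ s, f (s + w) * g s‖ ≤ (∫ s, ‖f s‖ ^ 2) + ∫ s, ‖g s‖ ^ 2 := by
  have hf2 := (memLp_two_iff_integrable_sq_norm hf.1).1 hf
  have hg2 := (memLp_two_iff_integrable_sq_norm hg.1).1 hg
  have hfs : Integrable (fun s => ‖f (s + w)‖ ^ 2) := hf2.comp_add_right w
  rw [← integral_add_right_eq_self (fun s => ‖f s‖ ^ 2) w, ← integral_add hfs hg2]
  refine norm_integral_le_of_norm_le (hfs.add hg2) (Eventually.of_forall fun s => ?_)
  rw [norm_mul]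
  nlinarith [sq_nonneg (‖f (s + w)‖ - ‖g s‖), sq_nonneg ‖f (s + w)‖, sq_nonneg ‖g s‖]

/-- A nonzero product needs s > b and s + w < u, so the lag stays below u - b. A correlation of L²
functions is bounded, hence square integrable on this bounded range. -/
lemma isCoef_corr {a b l u l' : ℝ} {f g : ℝ → ℂ} (hf : IsCoef l u f) (hg : IsCoef b l' g) :
    IsCoef a (u - b) (corr a f g) := by
  have hz : ∀ w, w ∉ Ioo a (u - b) → corr a f g w = 0 := by
    intro w hw
    unfold corr
    split_ifs with haw
    · have hw' : u - b ≤ w := by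
        by_contra hcon
        exact hw ⟨haw, not_le.1 hcon⟩
      convert integral_zero ℝ ℂ with s
      by_cases hs : b < s
      · rw [hf.eq_zero (s + w) fun h => by linarith [h.2], zero_mul]
      · rw [hg.eq_zero s fun h => hs h.1, mul_zero]
    · rfl
  refine ⟨?_, hz⟩
  have hmeas : AEStronglyMeasurable (corr a f g) volume := by
    have h1 := (integrable_shear hf.integrable hg.integrable).integral_prod_right
    have h2 : corr a f g = (Ioi a).indicator fun w => ∫ s, f (s + w) * g s := by
      funext w
      simp [corr, indicator]
    rw [h2]
    exact h1.aestronglyMeasurable.indicator measurableSet_Ioi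
  have h3 : corr a f g = (Icc a (u - b)).indicator (corr a f g) := by
    symm
    rw [indicator_eq_self]
    intro w hw
    by_contra hcon
    exact hw (hz w fun h => hcon (Ioo_subset_Icc_self h))
  rw [h3, memLp_indicator_iff_restrict measurableSet_Icc]
  refine MemLp.of_bound hmeas.restrict ((∫ s, ‖f s‖ ^ 2) + ∫ s, ‖g s‖ ^ 2)
    (Eventually.of_forall fun w => ?_)
  unfold corr
  split_ifs
  · exact norm_integral_shear_le hf.memLp hg.memLp w
  · rw [norm_zero]
    exact add_nonneg (integral_nonneg fun _ => by positivity) (integral_nonneg fun _ => by positivity)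

/-- Since lags exceed a, s > b forces s + w > a + b, and s + w < u forces s < u - a. The middle of
the support is thus partly invisible to the correlation, which is what makes the inversion
triangular. -/
lemma corr_congr {a b u l l' : ℝ} {f f' g g' : ℝ → ℂ} (hf : IsCoef l u f) (hf' : IsCoef l' u f')
    (hg : IsCoef b u g) (hg' : IsCoef b u g')
    (hff : ∀ᵐ t, t ∈ Ioo (a + b) u → f t = f' t) (hgg : ∀ᵐ t, t ∈ Ioo b (u - a) → g t = g' t)
    (w : ℝ) : corr a f g w = corr a f' g' w := by
  unfold corr
  split_ifs with haw
  · refine integral_congr_ae ?_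
    have hff' := (measurePreserving_add_right volume w).quasiMeasurePreserving.ae hff
    filter_upwards [hff', hgg] with s h1 h2
    by_cases hs : s ∈ Ioo b u
    · by_cases hsw : s + w < u
      · rw [h1 ⟨by linarith [hs.1], hsw⟩, h2 ⟨hs.1, by linarith⟩]
      · rw [hf.eq_zero _ fun h => hsw h.2, hf'.eq_zero _ fun h => hsw h.2, zero_mul, zero_mul]
    · rw [hg.eq_zero s hs, hg'.eq_zero s hs, mul_zero, mul_zero]
  · rfl

/-! ### The kernels of the characteristic functions and their inversion -/

/-- The kernel of the part of the solution that is odd in the potential with delay `a`. -/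
noncomputable def oddKernel (a b : ℝ) (κ : ℂ) (p r q s : ℝ → ℂ) (t : ℝ) : ℂ :=
  κ * p t + (corr a p s (t - b / 2) + corr b r q (t - (a - b / 2)))

/-- The kernel of the part of the solution that is even in the potential with delay `a`. -/
noncomputable def evenKernel (a b : ℝ) (κ : ℂ) (p r q s : ℝ → ℂ) (t : ℝ) : ℂ :=
  κ * r t + (corr a p q (t - b / 2) + corr b r s (t - b / 2))

lemma oddKernel_neg (a b : ℝ) (κ : ℂ) (p r q s : ℝ → ℂ) :
    oddKernel a b κ (-p) (-r) (-q) (-s) = oddKernel a b (-κ) p r q s := by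
  funext t
  simp [oddKernel, corr_neg_neg]

lemma evenKernel_neg (a b : ℝ) (κ : ℂ) (p r q s : ℝ → ℂ) :
    evenKernel a b κ (-p) (-r) (-q) (-s) = evenKernel a b (-κ) p r q s := by
  funext t
  simp [evenKernel, corr_neg_neg]

section Kernels

variable {a b : ℝ} {κ : ℂ} {p r q s p' r' q' s' : ℝ → ℂ}

lemma isCoef_oddKernel (ha : 0 < a) (hb : 0 < b) (hp : IsCoef a π p) (hr : IsCoef b π r)
    (hq : IsCoef a π q) (hs : IsCoef b π s) :
    IsCoef (a / 2) (π + a / 2) (oddKernel a b κ p r q s) :=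
  ((hp.const_mul κ).mono (by linarith) (by linarith)).add
    ((((isCoef_corr hp hs).comp_sub_right _).mono (by linarith) (by linarith)).add
      (((isCoef_corr hr hq).comp_sub_right _).mono (by linarith) (by linarith)))

lemma isCoef_evenKernel (ha : 0 < a) (hab : a < b) (hp : IsCoef a π p)
    (hr : IsCoef b π r) (hq : IsCoef a π q) (hs : IsCoef b π s) :
    IsCoef (b / 2) (π + b / 2) (evenKernel a b κ p r q s) :=
  ((hr.const_mul κ).mono (by linarith) (by linarith)).add
    ((((isCoef_corr hp hq).comp_sub_right _).mono (by linarith) (by linarith)).add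
      (((isCoef_corr hr hs).comp_sub_right _).mono (by linarith) (by linarith)))

lemma corr_eq_zero {l u l' : ℝ} {f g : ℝ → ℂ} (hf : IsCoef l u f) (hg : IsCoef b l' g) {w : ℝ}
    (hw : w ∉ Ioo a (u - b)) : corr a f g w = 0 :=
  (isCoef_corr hf hg).eq_zero w hw

/-- The lag ranges (a, π - b) and (b, π - a), shifted by b/2 and a - b/2, become the same interval
(a + b/2, π - b/2); elsewhere the kernel is κp. -/
lemma ae_eq_of_oddKernel_off (hκ : κ ≠ 0) (hp : IsCoef a π p) (hr : IsCoef b π r)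
    (hq : IsCoef a π q) (hs : IsCoef b π s) (hp' : IsCoef a π p') (hr' : IsCoef b π r')
    (hq' : IsCoef a π q') (hs' : IsCoef b π s')
    (h : oddKernel a b κ p r q s =ᵐ[volume] oddKernel a b κ p' r' q' s') :
    ∀ᵐ t, t ∉ Ioo (a + b / 2) (π - b / 2) → p t = p' t := by
  filter_upwards [h] with t ht htm
  have h1 : t - b / 2 ∉ Ioo a (π - b) := fun h => htm ⟨by linarith [h.1], by linarith [h.2]⟩
  have h2 : t - (a - b / 2) ∉ Ioo b (π - a) := fun h =>
    htm ⟨by linarith [h.1], by linarith [h.2]⟩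
  simp only [oddKernel, corr_eq_zero hp hs h1, corr_eq_zero hr hq h2, corr_eq_zero hp' hs' h1,
    corr_eq_zero hr' hq' h2, add_zero] at ht
  exact mul_left_cancel₀ hκ ht

lemma ae_eq_of_evenKernel_off (hκ : κ ≠ 0) (hr : IsCoef b π r) (hs : IsCoef b π s)
    (hr' : IsCoef b π r') (hs' : IsCoef b π s')
    (hpq : ∀ w, corr a p q w = corr a p' q' w)
    (h : evenKernel a b κ p r q s =ᵐ[volume] evenKernel a b κ p' r' q' s') :
    ∀ᵐ t, t ∉ Ioo (3 * b / 2) (π - b / 2) → r t = r' t := by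
  filter_upwards [h] with t ht htm
  have h1 : t - b / 2 ∉ Ioo b (π - b) := fun h => htm ⟨by linarith [h.1], by linarith [h.2]⟩
  simp only [evenKernel, corr_eq_zero hr hs h1, corr_eq_zero hr' hs' h1, hpq, add_zero,
    add_left_inj] at ht
  exact mul_left_cancel₀ hκ ht

lemma ae_eq_of_evenKernel (hκ : κ ≠ 0)
    (hpq : ∀ w, corr a p q w = corr a p' q' w) (hrs : ∀ w, corr b r s w = corr b r' s' w)
    (h : evenKernel a b κ p r q s =ᵐ[volume] evenKernel a b κ p' r' q' s') :
    r =ᵐ[volume] r' := by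
  filter_upwards [h] with t ht
  simp only [evenKernel, hpq, hrs, add_left_inj] at ht
  exact mul_left_cancel₀ hκ ht

lemma ae_eq_of_oddKernel (hκ : κ ≠ 0)
    (hps : ∀ w, corr a p s w = corr a p' s' w) (hrq : ∀ w, corr b r q w = corr b r' q' w)
    (h : oddKernel a b κ p r q s =ᵐ[volume] oddKernel a b κ p' r' q' s') :
    p =ᵐ[volume] p' := by
  filter_upwards [h] with t ht
  simp only [oddKernel, hps, hrq, add_left_inj] at ht
  exact mul_left_cancel₀ hκ ht

/-- The four kernels determine the four coefficients. -/
theorem coef_ae_eq_of_kernel_ae_eq (ha : a < 2 * π / 5)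
    (hab : π ≤ 2 * a + b / 2) (hκ : κ ≠ 0)
    (hp : IsCoef a π p) (hr : IsCoef b π r) (hq : IsCoef a π q) (hs : IsCoef b π s)
    (hp' : IsCoef a π p') (hr' : IsCoef b π r') (hq' : IsCoef a π q') (hs' : IsCoef b π s')
    (ho : oddKernel a b κ p r q s =ᵐ[volume] oddKernel a b κ p' r' q' s')
    (he : evenKernel a b κ p r q s =ᵐ[volume] evenKernel a b κ p' r' q' s')
    (ho' : oddKernel a b (-κ) q s p r =ᵐ[volume] oddKernel a b (-κ) q' s' p' r')
    (he' : evenKernel a b (-κ) q s p r =ᵐ[volume] evenKernel a b (-κ) q' s' p' r') :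
    p =ᵐ[volume] p' ∧ r =ᵐ[volume] r' ∧ q =ᵐ[volume] q' ∧ s =ᵐ[volume] s' := by
  have hκ' : -κ ≠ 0 := neg_ne_zero.2 hκ
  have hp0 := ae_eq_of_oddKernel_off hκ hp hr hq hs hp' hr' hq' hs' ho
  have hq0 := ae_eq_of_oddKernel_off hκ' hq hs hp hr hq' hs' hp' hr' ho'
  -- The correlation reads p on (2a, π) and q on (a, π - a). By 2a + b/2 ≥ π both ranges miss (a +
  -- b/2, π - b/2).
  have hpq : ∀ w, corr a p q w = corr a p' q' w := corr_congr hp hp' hq hq'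
    (hp0.mono fun t ht hm => ht fun h => by linarith [hm.1, h.2])
    (hq0.mono fun t ht hm => ht fun h => by linarith [hm.2, h.1])
  have hqp : ∀ w, corr a q p w = corr a q' p' w := corr_congr hq hq' hp hp'
    (hq0.mono fun t ht hm => ht fun h => by linarith [hm.1, h.2])
    (hp0.mono fun t ht hm => ht fun h => by linarith [hm.2, h.1])
  have hr0 := ae_eq_of_evenKernel_off hκ hr hs hr' hs' hpq he
  have hs0 := ae_eq_of_evenKernel_off hκ' hs hr hs' hr' hqp he'
  -- The ranges (2b, π) and (b, π - b) miss (3b/2, π - b/2) because b ≥ 2π/5, a consequence of a <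
  -- 2π/5 and 2a + b/2 ≥ π.
  have hrs : ∀ w, corr b r s w = corr b r' s' w := corr_congr hr hr' hs hs'
    (hr0.mono fun t ht hm => ht fun h => by linarith [hm.1, h.2])
    (hs0.mono fun t ht hm => ht fun h => by linarith [hm.2, h.1])
  have hsr : ∀ w, corr b s r w = corr b s' r' w := corr_congr hs hs' hr hr'
    (hs0.mono fun t ht hm => ht fun h => by linarith [hm.1, h.2])
    (hr0.mono fun t ht hm => ht fun h => by linarith [hm.2, h.1])
  have hreq := ae_eq_of_evenKernel hκ hpq hrs he
  have hseq := ae_eq_of_evenKernel hκ' hqp hsr he'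
  -- With r and s known everywhere, the mixed correlations need p and q only on (a + b, π) and (a, π
  -- - b), where they are known because a + 3b/2 ≥ π.
  refine ⟨ae_eq_of_oddKernel hκ ?_ ?_ ho, hreq, ae_eq_of_oddKernel hκ' ?_ ?_ ho', hseq⟩
  · exact corr_congr hp hp' hs hs'
      (hp0.mono fun t ht hm => ht fun h => by linarith [hm.1, h.2]) (hseq.mono fun t ht _ => ht)
  · exact corr_congr hr hr' hq hq' (hreq.mono fun t ht _ => ht)
      (hq0.mono fun t ht hm => ht fun h => by linarith [hm.2, h.1])
  · exact corr_congr hq hq' hr hr'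
      (hq0.mono fun t ht hm => ht fun h => by linarith [hm.1, h.2]) (hreq.mono fun t ht _ => ht)
  · exact corr_congr hs hs' hp hp' (hseq.mono fun t ht _ => ht)
      (hp0.mono fun t ht hm => ht fun h => by linarith [hm.2, h.1])

end Kernels

/-! ### The system in diagonal form and its integral equations -/

/-- The right hand side of the integral equation for `U' = i z U - i (p V(· - a) + r V(· - b))`,
`U(0) = c`. -/
noncomputable def delayStep (a b : ℝ) (z c : ℂ) (p r V : ℝ → ℂ) (x : ℝ) : ℂ :=
  Complex.exp (Complex.I * z * x) * (c - Complex.I *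
    ∫ t in (0 : ℝ)..x, Complex.exp (-(Complex.I * z * t)) * (p t * V (t - a) + r t * V (t - b)))

/-- The Picard iterates of the system of integral equations. -/
noncomputable def delayIter (a b : ℝ) (z c d : ℂ) (p r q s : ℝ → ℂ) : ℕ → (ℝ → ℂ) × (ℝ → ℂ)
  | 0 => (0, 0)
  | n + 1 => (delayStep a b z c p r (delayIter a b z c d p r q s n).2,
      delayStep a b (-z) d (-q) (-s) (delayIter a b z c d p r q s n).1)

/-- Exchanging the two unknowns amounts to z ↦ -z and (p, r) ↔ (-q, -s), so only the first component
has to be computed. -/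
lemma delayIter_snd (a b : ℝ) (z c d : ℂ) (p r q s : ℝ → ℂ) (n : ℕ) :
    (delayIter a b z c d p r q s n).2 =
      (delayIter a b (-z) d c (-q) (-s) (-p) (-r) n).1 ∧
    (delayIter a b z c d p r q s n).1 =
      (delayIter a b (-z) d c (-q) (-s) (-p) (-r) n).2 := by
  induction n with
  | zero => simp [delayIter]
  | succ n ih => simp [delayIter, ih.1, ih.2]

section Integral

variable {a b δ z c d : _} {p r q s V V' U U' : ℝ → ℂ}

lemma delayStep_zero (a b : ℝ) (z c : ℂ) (p r V : ℝ → ℂ) : delayStep a b z c p r V 0 = c := by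
  simp [delayStep]

lemma delayStep_const_mul (a b : ℝ) (z c k : ℂ) (p r V : ℝ → ℂ) (x : ℝ) :
    delayStep a b z (k * c) p r (fun t => k * V t) x = k * delayStep a b z c p r V x := by
  have h : ∀ t : ℝ, Complex.exp (-(Complex.I * z * t)) *
      (p t * (k * V (t - a)) + r t * (k * V (t - b))) =
      k * (Complex.exp (-(Complex.I * z * t)) * (p t * V (t - a) + r t * V (t - b))) :=
    fun t => by ring
  simp only [delayStep, h, intervalIntegral.integral_const_mul]
  ring

/-- The integrand at t reads V no later than t - δ, so agreement moves right by one delay. -/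
lemma delayStep_congr {x₀ : ℝ} (hδa : δ ≤ a) (hδb : δ ≤ b) (hp : IsCoef a π p) (hr : IsCoef b π r)
    (h : ∀ t ∈ Ico 0 x₀, V t = V' t) :
    ∀ x ∈ Icc 0 (x₀ + δ), delayStep a b z c p r V x = delayStep a b z c p r V' x := by
  intro x hx
  unfold delayStep
  congr 3
  refine intervalIntegral.integral_congr_ae ?_
  -- For x = x₀ + δ the endpoint t = x could read V at x₀, where agreement is not assumed; it is a
  -- null set.
  have hne : ∀ᵐ t : ℝ, t ≠ x := by simp [ae_iff, measure_singleton]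
  filter_upwards [hne] with t htx ht
  rw [uIoc_of_le hx.1] at ht
  have htx' : t < x := lt_of_le_of_ne ht.2 htx
  congr 2
  · by_cases hta : a < t
    · rw [h _ ⟨by linarith, by linarith [hx.2]⟩]
    · rw [hp.eq_zero t fun h => hta h.1, zero_mul, zero_mul]
  · by_cases hta : b < t
    · rw [h _ ⟨by linarith, by linarith [hx.2]⟩]
    · rw [hr.eq_zero t fun h => hta h.1, zero_mul, zero_mul]

lemma integrable_delay_integrand (hp : IsCoef a π p) (hr : IsCoef b π r) (hV : Continuous V) :
    Integrable fun t : ℝ =>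
      Complex.exp (-(Complex.I * z * t)) * (p t * V (t - a) + r t * V (t - b)) := by
  have h1 : Integrable fun t : ℝ => p t * (Complex.exp (-(Complex.I * z * t)) * V (t - a)) :=
    hp.mul_continuous (by fun_prop)
  have h2 : Integrable fun t : ℝ => r t * (Complex.exp (-(Complex.I * z * t)) * V (t - b)) :=
    hr.mul_continuous (by fun_prop)
  refine (h1.add h2).congr (Eventually.of_forall fun t => ?_)
  simp only [Pi.add_apply]
  ring

lemma continuous_delayStep (hp : IsCoef a π p) (hr : IsCoef b π r) (hV : Continuous V) :
    Continuous (delayStep a b z c p r V) := by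
  have h1 := (integrable_delay_integrand (z := z) hp hr hV).continuous_primitive 0
  unfold delayStep
  fun_prop

lemma continuous_delayIter (hp : IsCoef a π p) (hr : IsCoef b π r) (hq : IsCoef a π q)
    (hs : IsCoef b π s) (n : ℕ) :
    Continuous (delayIter a b z c d p r q s n).1 ∧ Continuous (delayIter a b z c d p r q s n).2 := by
  induction n with
  | zero => exact ⟨continuous_const, continuous_const⟩
  | succ n ih =>
    exact ⟨continuous_delayStep hp hr ih.2, continuous_delayStep hq.neg hs.neg ih.1⟩

/-! ### Absolute continuity, and passage between differential and integral equations. -/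

lemma absolutelyContinuous_primitive {g : ℝ → ℂ} (hg : Integrable g) (l u : ℝ) :
    AbsolutelyContinuousOnInterval (fun x => ∫ t in (0 : ℝ)..x, g t) l u := by
  have h1 : AbsolutelyContinuousOnInterval (fun x => ∫ t in l..x, ‖g t‖) l u :=
    hg.norm.intervalIntegrable.absolutelyContinuousOnInterval_intervalIntegral (by simp)
  refine squeeze_zero (fun E => Finset.sum_nonneg fun i _ => dist_nonneg) (fun E => ?_) h1
  refine Finset.sum_le_sum fun i _ => ?_
  rw [dist_comm, dist_eq_norm, dist_comm, Real.dist_eq,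
    intervalIntegral.integral_interval_sub_left hg.intervalIntegrable hg.intervalIntegrable,
    intervalIntegral.integral_interval_sub_left hg.norm.intervalIntegrable
      hg.norm.intervalIntegrable]
  exact intervalIntegral.norm_integral_le_abs_integral_norm

lemma absolutelyContinuous_exp (k : ℂ) (l u : ℝ) :
    AbsolutelyContinuousOnInterval (fun x : ℝ => Complex.exp (k * x)) l u := by
  refine ContDiffOn.absolutelyContinuousOnInterval (ContDiff.contDiffOn ?_)
  exact (contDiff_const.mul Complex.ofRealCLM.contDiff).cexp

lemma absolutelyContinuous_const {l u : ℝ} (k : ℂ) :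
    AbsolutelyContinuousOnInterval (fun _ : ℝ => k) l u :=
  ContDiffOn.absolutelyContinuousOnInterval contDiffOn_const

lemma absolutelyContinuous_delayStep (hp : IsCoef a π p) (hr : IsCoef b π r) (hV : Continuous V) :
    AbsolutelyContinuousOnInterval (delayStep a b z c p r V) 0 π :=
  (absolutelyContinuous_exp (Complex.I * z) 0 π).fun_smul
    ((absolutelyContinuous_const c).fun_sub
      ((absolutelyContinuous_primitive (integrable_delay_integrand hp hr hV) 0 π).const_smul
        Complex.I))

lemma hasDerivAt_exp_mul (k : ℂ) (x : ℝ) :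
    HasDerivAt (fun x : ℝ => Complex.exp (k * x)) (k * Complex.exp (k * x)) x := by
  have h1 : HasDerivAt (fun x : ℝ => k * (x : ℂ)) k x := by
    simpa using (HasDerivAt.ofReal_comp (hasDerivAt_id x)).const_mul k
  simpa [mul_comm] using h1.cexp

lemma ae_hasDerivAt_delayStep (hp : IsCoef a π p) (hr : IsCoef b π r) (hV : Continuous V) :
    ∀ᵐ x : ℝ, HasDerivAt (delayStep a b z c p r V)
      (Complex.I * z * delayStep a b z c p r V x -
        Complex.I * (p x * V (x - a) + r x * V (x - b))) x := by
  have h1 := LocallyIntegrable.ae_hasDerivAt_integral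
    (integrable_delay_integrand (z := z) hp hr hV).locallyIntegrable
  filter_upwards [h1] with x hx
  have h2 := (hasDerivAt_exp_mul (Complex.I * z) x).mul (((hx 0).const_mul Complex.I).const_sub c)
  refine h2.congr_deriv ?_
  simp only [delayStep]
  have h3 : Complex.exp (Complex.I * z * x) * Complex.exp (-(Complex.I * z * x)) = 1 := by
    rw [← Complex.exp_add]; simp
  linear_combination (-Complex.I * (p x * V (x - a) + r x * V (x - b))) * h3

/-- An absolutely continuous solution of the differential equation satisfies the integral
equation. -/
lemma eq_delayStep_of_ae_hasDerivAt (hp : IsCoef a π p) (hr : IsCoef b π r) (ha : 0 < a)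
    (hb : 0 < b) (hU : AbsolutelyContinuousOnInterval U 0 π) (hV : ContinuousOn V (Icc 0 π))
    (hd : ∀ᵐ x, x ∈ Icc 0 π → HasDerivAt U (Complex.I * z * U x -
      Complex.I * (p x * V (x - a) + r x * V (x - b))) x) :
    ∀ x ∈ Icc 0 π, U x = delayStep a b z (U 0) p r V x := by
  -- A continuous extension of V from [0, π]. The coefficients vanish wherever a delayed argument
  -- leaves [0, π], so nothing changes in the equation.
  set W : ℝ → ℂ := IccExtend Real.pi_pos.le ((Icc 0 π).domRestrict V) with hW
  have hWc : Continuous W := continuousOn_iff_continuous_domRestrict.1 hV |>.Icc_extend'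
  have hWV : ∀ t ∈ Icc 0 π, W t = V t := fun t ht => by
    rw [hW, IccExtend_of_mem _ _ ht, domRestrict_apply]
  have hpV : ∀ t, p t * V (t - a) = p t * W (t - a) := by
    intro t
    by_cases ht : t ∈ Ioo a π
    · rw [hWV _ ⟨by linarith [ht.1], by linarith [ht.2]⟩]
    · rw [hp.eq_zero t ht, zero_mul, zero_mul]
  have hrV : ∀ t, r t * V (t - b) = r t * W (t - b) := by
    intro t
    by_cases ht : t ∈ Ioo b π
    · rw [hWV _ ⟨by linarith [ht.1], by linarith [ht.2]⟩]
    · rw [hr.eq_zero t ht, zero_mul, zero_mul]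
  simp only [delayStep, hpV, hrV] at hd ⊢
  have hint := integrable_delay_integrand (z := z) hp hr hWc
  -- Variation of constants: this function is absolutely continuous with zero derivative almost
  -- everywhere, hence constant.
  have hac : AbsolutelyContinuousOnInterval (fun x : ℝ => Complex.exp (-(Complex.I * z) * x) • U x +
      Complex.I • ∫ t in (0 : ℝ)..x, Complex.exp (-(Complex.I * z * t)) *
        (p t * W (t - a) + r t * W (t - b))) 0 π :=
    ((absolutelyContinuous_exp (-(Complex.I * z)) 0 π).fun_smul hU).fun_add
      ((absolutelyContinuous_primitive hint 0 π).const_smul Complex.I)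
  obtain ⟨C, hC⟩ := hac.const_of_ae_hasDerivAt_zero (by
    filter_upwards [hd, LocallyIntegrable.ae_hasDerivAt_integral hint.locallyIntegrable]
      with x hx hx2 hxm
    rw [uIcc_of_le Real.pi_pos.le] at hxm
    have h2 := ((hasDerivAt_exp_mul (-(Complex.I * z)) x).smul (hx hxm)).add
      ((hx2 0).const_smul Complex.I)
    refine h2.congr_deriv ?_
    simp only [smul_eq_mul, neg_mul]
    ring)
  rw [uIcc_of_le Real.pi_pos.le] at hC
  have h0 := hC 0 ⟨le_rfl, Real.pi_pos.le⟩
  simp only [Complex.ofReal_zero, mul_zero, Complex.exp_zero, one_smul,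
    intervalIntegral.integral_same, smul_zero, add_zero] at h0
  intro x hx
  have h1 := hC x hx
  rw [← h0] at h1
  simp only [smul_eq_mul, neg_mul] at h1
  have h3 : Complex.exp (Complex.I * z * x) * Complex.exp (-(Complex.I * z * x)) = 1 := by
    rw [← Complex.exp_add]; simp
  rw [← h1]
  linear_combination (-U x) * h3

/-- The integral equations have at most one solution. -/
lemma integral_equations_unique (hδ : 0 < δ) (hδa : δ ≤ a) (hδb : δ ≤ b) (hp : IsCoef a π p)
    (hr : IsCoef b π r) (hq : IsCoef a π q) (hs : IsCoef b π s)
    (hU : ∀ x ∈ Icc 0 π, U x = delayStep a b z c p r V x)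
    (hV : ∀ x ∈ Icc 0 π, V x = delayStep a b (-z) d (-q) (-s) U x)
    (hU' : ∀ x ∈ Icc 0 π, U' x = delayStep a b z c p r V' x)
    (hV' : ∀ x ∈ Icc 0 π, V' x = delayStep a b (-z) d (-q) (-s) U' x) :
    ∀ x ∈ Icc 0 π, U x = U' x ∧ V x = V' x := by
  -- Method of steps: each induction step extends uniqueness by δ.
  have key : ∀ n : ℕ, ∀ x ∈ Ico 0 (min (n * δ) (π + δ)), x ≤ π → U x = U' x ∧ V x = V' x := by
    intro n
    induction n with
    | zero =>
      intro x hx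
      have := hx.2.trans_le (min_le_left _ _)
      simp only [Nat.cast_zero, zero_mul] at this
      exact absurd hx.1 (not_le.2 this)
    | succ n ih =>
      intro x hx hxpi
      have hxn : x < (n + 1 : ℕ) * δ := hx.2.trans_le (min_le_left _ _)
      push_cast at hxn
      have hxm : x ∈ Icc 0 ((x - δ) + δ) := ⟨hx.1, by linarith⟩
      have hag : ∀ t ∈ Ico 0 (x - δ), U t = U' t ∧ V t = V' t := fun t ht =>
        ih t ⟨ht.1, lt_min (by linarith [ht.2]) (by linarith [ht.2])⟩ (by linarith [ht.2])
      constructor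
      · rw [hU x ⟨hx.1, hxpi⟩, hU' x ⟨hx.1, hxpi⟩]
        exact delayStep_congr hδa hδb hp hr (fun t ht => (hag t ht).2) x hxm
      · rw [hV x ⟨hx.1, hxpi⟩, hV' x ⟨hx.1, hxpi⟩]
        exact delayStep_congr hδa hδb hq.neg hs.neg (fun t ht => (hag t ht).1) x hxm
  intro x hx
  obtain ⟨n, hn⟩ := exists_nat_gt (π / δ)
  rw [div_lt_iff₀ hδ] at hn
  exact key n x ⟨hx.1, lt_min (by linarith [hx.2]) (by linarith [hx.2])⟩ hx.2

lemma delayIter_succ_eq (hδa : δ ≤ a) (hδb : δ ≤ b) (hp : IsCoef a π p)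
    (hr : IsCoef b π r) (hq : IsCoef a π q) (hs : IsCoef b π s) (n : ℕ) :
    ∀ x ∈ Ico 0 (n * δ), (delayIter a b z c d p r q s n).1 x =
        (delayIter a b z c d p r q s (n + 1)).1 x ∧
      (delayIter a b z c d p r q s n).2 x = (delayIter a b z c d p r q s (n + 1)).2 x := by
  induction n with
  | zero =>
    intro x hx
    simp only [Nat.cast_zero, zero_mul, Ico_self, mem_empty_iff_false] at hx
  | succ n ih =>
    intro x hx
    have hxm : x ∈ Icc 0 (n * δ + δ) := ⟨hx.1, by have := hx.2; push_cast at this; linarith⟩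
    exact ⟨delayStep_congr hδa hδb hp hr (fun t ht => (ih t ht).2) x hxm,
      delayStep_congr hδa hδb hq.neg hs.neg (fun t ht => (ih t ht).1) x hxm⟩

end Integral

/-! ### The solution at the right endpoint -/

section Endpoint

variable {a b : ℝ} {p r q s f g : ℝ → ℂ}

/-- The combined phase depends only on the lag t - σ, so it factors out of the correlation. The
translation θ is free and serves to match the phase of a linear term. -/
lemma integral_mul_integral_eq_corr {l l' : ℝ} (z : ℂ) (θ : ℝ) (hl' : 0 ≤ l')
    (hf : IsCoef l π f) (hl : a ≤ l) (hg : IsCoef l' π g) :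
    ∫ t : ℝ, f t * Complex.exp (-(Complex.I * z * (2 * t - a))) *
      ∫ σ in (0 : ℝ)..(t - a), g σ * Complex.exp (Complex.I * z * (2 * σ - b)) =
    ∫ t : ℝ, corr a f g (t - θ) * Complex.exp (-(Complex.I * z * (2 * (t - θ) - a + b))) := by
  have hF := hf.mul_continuous (e := fun t : ℝ => Complex.exp (-(Complex.I * z * (2 * t - a))))
    (by fun_prop)
  have hG := hg.mul_continuous (e := fun t : ℝ => Complex.exp (Complex.I * z * (2 * t - b)))
    (by fun_prop)
  have h1 := integral_corr a hF hG
  have h2 : ∀ w : ℝ, corr a (fun t : ℝ => f t * Complex.exp (-(Complex.I * z * (2 * t - a))))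
      (fun t : ℝ => g t * Complex.exp (Complex.I * z * (2 * t - b))) w =
      corr a f g w * Complex.exp (-(Complex.I * z * (2 * w - a + b))) := by
    intro w
    unfold corr
    split_ifs
    · rw [← integral_mul_const]
      congr 1
      funext t
      have : Complex.exp (-(Complex.I * z * (2 * ((t + w : ℝ) : ℂ) - a))) *
          Complex.exp (Complex.I * z * (2 * t - b)) =
          Complex.exp (-(Complex.I * z * (2 * w - a + b))) := by
        rw [← Complex.exp_add]
        congr 1
        push_cast; ring
      rw [← this]; ring
    · simp
  simp only [h2] at h1
  rw [← integral_sub_right_eq_self _ θ] at h1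
  simp only [Complex.ofReal_sub] at h1
  rw [h1]
  congr 1
  funext t
  by_cases ht : l < t
  · congr 1
    have hta : 0 ≤ t - a := by linarith
    rw [intervalIntegral.integral_of_le hta, integral_Ioc_eq_integral_Ioo,
      ← integral_indicator measurableSet_Ioo, ← integral_indicator measurableSet_Iio]
    congr 1
    funext σ
    by_cases hσ : 0 < σ
    · simp [indicator, hσ]
    · have h0 : g σ = 0 := hg.eq_zero σ fun h => hσ (hl'.trans_lt h.1)
      simp [indicator, h0]
  · rw [hf.eq_zero t fun h => ht h.1, zero_mul, zero_mul, zero_mul]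

lemma expTransform_eq_mul {x : ℝ} (a : ℝ) (f : ℝ → ℂ) (z : ℂ) :
    expTransform (x + a) f z = Complex.exp (Complex.I * z * x) *
      ∫ t : ℝ, f t * Complex.exp (-(Complex.I * z * (2 * t - a))) := by
  rw [expTransform, ← integral_const_mul]
  congr 1
  funext t
  rw [mul_left_comm, ← Complex.exp_add]
  congr 2
  push_cast; ring

lemma delayIter_one_fst (a b : ℝ) (z c d : ℂ) (p r q s : ℝ → ℂ) (x : ℝ) :
    (delayIter a b z c d p r q s 1).1 x = c * Complex.exp (Complex.I * z * x) := by
  simp [delayIter, delayStep, mul_comm]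

lemma delayIter_two_snd (z c : ℂ) (hq : IsCoef a π q)
    (hs : IsCoef b π s) (x : ℝ) :
    (delayIter a b z c (-c) p r q s 2).2 x = -c * Complex.exp (-(Complex.I * z * x)) *
      (1 - Complex.I *
        ((∫ σ in (0 : ℝ)..x, q σ * Complex.exp (Complex.I * z * (2 * σ - a))) +
        ∫ σ in (0 : ℝ)..x, s σ * Complex.exp (Complex.I * z * (2 * σ - b)))) := by
  have hqi := hq.mul_continuous (e := fun t : ℝ => Complex.exp (Complex.I * z * (2 * t - a)))
    (by fun_prop)
  have hsi := hs.mul_continuous (e := fun t : ℝ => Complex.exp (Complex.I * z * (2 * t - b)))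
    (by fun_prop)
  rw [← intervalIntegral.integral_add hqi.intervalIntegrable hsi.intervalIntegrable]
  change delayStep a b (-z) (-c) (-q) (-s) (delayIter a b z c (-c) p r q s 1).1 x = _
  have h : ∀ t : ℝ, Complex.exp (-(Complex.I * -z * t)) * ((-q) t *
      (delayIter a b z c (-c) p r q s 1).1 (t - a) + (-s) t *
      (delayIter a b z c (-c) p r q s 1).1 (t - b)) = -c * (q t *
      Complex.exp (Complex.I * z * (2 * t - a)) +
      s t * Complex.exp (Complex.I * z * (2 * t - b))) := by
    intro t
    simp only [delayIter_one_fst, Pi.neg_apply]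
    have h1 : Complex.exp (Complex.I * z * (2 * t - a)) =
        Complex.exp (-(Complex.I * -z * t)) * Complex.exp (Complex.I * z * ((t - a : ℝ) : ℂ)) := by
      rw [← Complex.exp_add]; congr 1; push_cast; ring
    have h2 : Complex.exp (Complex.I * z * (2 * t - b)) =
        Complex.exp (-(Complex.I * -z * t)) * Complex.exp (Complex.I * z * ((t - b : ℝ) : ℂ)) := by
      rw [← Complex.exp_add]; congr 1; push_cast; ring
    rw [h1, h2]; ring
  simp only [delayStep, h, intervalIntegral.integral_const_mul]
  rw [show Complex.I * -z * (x : ℂ) = -(Complex.I * z * x) by ring]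
  ring

lemma delayIter_three_fst (ha : 0 < a) (hb : 0 < b) (z c : ℂ) (hp : IsCoef a π p)
    (hr : IsCoef b π r) (hq : IsCoef a π q) (hs : IsCoef b π s) :
    (delayIter a b z c (-c) p r q s 3).1 π = c * (Complex.exp (Complex.I * z * π) +
      (expTransform (π + a) (oddKernel a b Complex.I p r q s) z +
      expTransform (π + b) (evenKernel a b Complex.I p r q s) z)) := by
  set eq : ℝ → ℂ := fun x => ∫ σ in (0 : ℝ)..x, q σ * Complex.exp (Complex.I * z * (2 * σ - a))
    with heq
  set es : ℝ → ℂ := fun x => ∫ σ in (0 : ℝ)..x, s σ * Complex.exp (Complex.I * z * (2 * σ - b))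
    with hes
  have heqc : Continuous eq := (hq.mul_continuous
    (e := fun t : ℝ => Complex.exp (Complex.I * z * (2 * t - a))) (by fun_prop)).continuous_primitive
    0
  have hesc : Continuous es := (hs.mul_continuous
    (e := fun t : ℝ => Complex.exp (Complex.I * z * (2 * t - b))) (by fun_prop)).continuous_primitive
    0
  set ea : ℝ → ℂ := fun t => Complex.exp (-(Complex.I * z * (2 * t - a))) with hea
  set eb : ℝ → ℂ := fun t => Complex.exp (-(Complex.I * z * (2 * t - b))) with heb
  have heac : Continuous ea := by rw [hea]; fun_prop
  have hebc : Continuous eb := by rw [heb]; fun_prop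
  have hpa : Integrable fun t => p t * ea t := hp.mul_continuous heac
  have hrb : Integrable fun t => r t * eb t := hr.mul_continuous hebc
  have hpq : Integrable fun t => p t * (ea t * eq (t - a)) := hp.mul_continuous (by fun_prop)
  have hps : Integrable fun t => p t * (ea t * es (t - a)) := hp.mul_continuous (by fun_prop)
  have hrq : Integrable fun t => r t * (eb t * eq (t - b)) := hr.mul_continuous (by fun_prop)
  have hrs : Integrable fun t => r t * (eb t * es (t - b)) := hr.mul_continuous (by fun_prop)
  have hstep : ∀ t : ℝ, Complex.exp (-(Complex.I * z * t)) * (p t *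
      (delayIter a b z c (-c) p r q s 2).2 (t - a) + r t *
      (delayIter a b z c (-c) p r q s 2).2 (t - b)) =
      -c * (p t * ea t + r t * eb t - Complex.I * ((p t * (ea t * eq (t - a)) +
        p t * (ea t * es (t - a))) + (r t * (eb t * eq (t - b)) + r t * (eb t * es (t - b))))) := by
    intro t
    have h1 : ea t = Complex.exp (-(Complex.I * z * t)) *
        Complex.exp (-(Complex.I * z * ((t - a : ℝ) : ℂ))) := by
      simp only [← Complex.exp_add, hea]; congr 1; push_cast; ring
    have h2 : eb t = Complex.exp (-(Complex.I * z * t)) *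
        Complex.exp (-(Complex.I * z * ((t - b : ℝ) : ℂ))) := by
      simp only [← Complex.exp_add, heb]; congr 1; push_cast; ring
    rw [delayIter_two_snd z c hq hs, delayIter_two_snd z c hq hs, h1, h2]
    simp only [heq, hes]
    ring
  have hint : ∫ t in (0 : ℝ)..π, Complex.exp (-(Complex.I * z * t)) * (p t *
      (delayIter a b z c (-c) p r q s 2).2 (t - a) + r t *
      (delayIter a b z c (-c) p r q s 2).2 (t - b)) =
      -c * ((∫ t, p t * ea t) + (∫ t, r t * eb t) - Complex.I *
        (((∫ t, p t * (ea t * eq (t - a))) + (∫ t, p t * (ea t * es (t - a)))) +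
        ((∫ t, r t * (eb t * eq (t - b))) + ∫ t, r t * (eb t * es (t - b))))) := by
    simp only [hstep]
    have i1 : Integrable fun t => p t * (ea t * eq (t - a)) + p t * (ea t * es (t - a)) :=
      hpq.add hps
    have i2 : Integrable fun t => r t * (eb t * eq (t - b)) + r t * (eb t * es (t - b)) :=
      hrq.add hrs
    have i4 : Integrable fun t => (p t * (ea t * eq (t - a)) + p t * (ea t * es (t - a))) +
        (r t * (eb t * eq (t - b)) + r t * (eb t * es (t - b))) := i1.add i2
    have i3 : Integrable fun t => p t * ea t + r t * eb t := hpa.add hrb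
    rw [← integral_add hpq hps, ← integral_add hrq hrs,
      ← integral_add i1 i2, ← integral_const_mul, ← integral_add hpa hrb,
      ← integral_sub i3 (i4.const_mul Complex.I),
      ← integral_const_mul, intervalIntegral.integral_of_le Real.pi_pos.le]
    refine setIntegral_eq_integral_of_forall_compl_eq_zero fun t ht => ?_
    rw [hp.eq_zero t fun h => ht ⟨ha.trans h.1, h.2.le⟩,
      hr.eq_zero t fun h => ht ⟨hb.trans h.1, h.2.le⟩]
    ring
  have cpq := integral_mul_integral_eq_corr (a := a) (b := a) z (b / 2) ha.le hp le_rfl hq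
  have cps := integral_mul_integral_eq_corr (a := a) (b := b) z (b / 2) hb.le hp le_rfl hs
  have crq := integral_mul_integral_eq_corr (a := b) (b := a) z (a - b / 2) ha.le hr le_rfl hq
  have crs := integral_mul_integral_eq_corr (a := b) (b := b) z (b / 2) hb.le hr le_rfl hs
  -- The shifts are fixed by 2θ + x - y = a for ps and rq, and = b for pq and rs: these are the
  -- phases of the linear terms in p and r.
  have shift : ∀ (x y θ k : ℝ), 2 * θ + x - y = k → ∀ t : ℝ,
      Complex.exp (-(Complex.I * z * (2 * ((t : ℂ) - (θ : ℂ)) - x + y))) =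
      Complex.exp (-(Complex.I * z * (2 * t - k))) := by
    intro x y θ k hk t
    rw [← hk]; congr 1; push_cast; ring
  simp only [shift a a (b / 2) b (by ring)] at cpq
  simp only [shift a b (b / 2) a (by ring)] at cps
  simp only [shift b a (a - b / 2) a (by ring)] at crq
  simp only [shift b b (b / 2) b (by ring)] at crs
  have ipq : Integrable fun t => corr a p q (t - b / 2) * eb t :=
    ((isCoef_corr hp hq).comp_sub_right _).mul_continuous hebc
  have ips : Integrable fun t => corr a p s (t - b / 2) * ea t :=
    ((isCoef_corr hp hs).comp_sub_right _).mul_continuous heac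
  have irq : Integrable fun t => corr b r q (t - (a - b / 2)) * ea t :=
    ((isCoef_corr hr hq).comp_sub_right _).mul_continuous heac
  have irs : Integrable fun t => corr b r s (t - b / 2) * eb t :=
    ((isCoef_corr hr hs).comp_sub_right _).mul_continuous hebc
  have hodd : ∫ t, oddKernel a b Complex.I p r q s t * ea t = Complex.I * (∫ t, p t * ea t) +
      ((∫ t, p t * (ea t * es (t - a))) + ∫ t, r t * (eb t * eq (t - b))) := by
    have i1 : Integrable fun t => corr a p s (t - b / 2) * ea t +
        corr b r q (t - (a - b / 2)) * ea t := ips.add irq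
    simp only [← mul_assoc]
    rw [cps, crq, ← integral_add ips irq, ← integral_const_mul,
      ← integral_add (hpa.const_mul _) i1]
    congr 1
    funext t
    simp only [oddKernel]
    ring
  have heven : ∫ t, evenKernel a b Complex.I p r q s t * eb t = Complex.I * (∫ t, r t * eb t) +
      ((∫ t, p t * (ea t * eq (t - a))) + ∫ t, r t * (eb t * es (t - b))) := by
    have i1 : Integrable fun t => corr a p q (t - b / 2) * eb t +
        corr b r s (t - b / 2) * eb t := ipq.add irs
    simp only [← mul_assoc]
    rw [cpq, crs, ← integral_add ipq irs, ← integral_const_mul,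
      ← integral_add (hrb.const_mul _) i1]
    congr 1
    funext t
    simp only [evenKernel]
    ring
  rw [expTransform_eq_mul, expTransform_eq_mul, hodd, heven]
  change delayStep a b z c p r (delayIter a b z c (-c) p r q s 2).2 π = _
  rw [delayStep, hint]
  linear_combination (-c * Complex.exp (Complex.I * z * π) *
    (((∫ t, p t * (ea t * eq (t - a))) + (∫ t, p t * (ea t * es (t - a)))) +
        ((∫ t, r t * (eb t * eq (t - b))) + ∫ t, r t * (eb t * es (t - b))))) * Complex.I_sq

lemma delayIter_three_snd (ha : 0 < a) (hb : 0 < b) (z c : ℂ) (hp : IsCoef a π p)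
    (hr : IsCoef b π r) (hq : IsCoef a π q) (hs : IsCoef b π s) :
    (delayIter a b z c (-c) p r q s 3).2 π = -c * (Complex.exp (-(Complex.I * z * π)) +
      (expTransform (π + a) (oddKernel a b (-Complex.I) q s p r) (-z) +
      expTransform (π + b) (evenKernel a b (-Complex.I) q s p r) (-z))) := by
  have h := delayIter_three_fst ha hb (-z) (-c) hq.neg hs.neg hp.neg hr.neg
  rw [neg_neg, oddKernel_neg, evenKernel_neg] at h
  rw [(delayIter_snd a b z c (-c) p r q s 3).1, h]
  congr 3
  ring

end Endpoint

/-! ### Diagonalization of the Dirac system -/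

/-- The potential matrix with entries `p₁, p₂` expressed by `p = p₁ + i p₂` and `q = p₁ - i p₂`. -/
noncomputable def coefMatrix (p q : ℂ) : Matrix (Fin 2) (Fin 2) ℂ :=
  !![(p + q) / 2, (p - q) / (2 * Complex.I); (p - q) / (2 * Complex.I), -((p + q) / 2)]

lemma exists_isCoef_of_isPotential {a : ℝ} {P : ℝ → Matrix (Fin 2) (Fin 2) ℂ} (ha : 0 < a)
    (hP : IsPotential a P) : ∃ p q : ℝ → ℂ, IsCoef a π p ∧ IsCoef a π q ∧
      ∀ᵐ x ∂(volume.restrict (Ioo 0 π)), P x = coefMatrix (p x) (q x) := by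
  obtain ⟨⟨p₁, p₂, h₁, h₂, hform⟩, hzero⟩ := hP
  have hsub : Ioo a π ⊆ Icc 0 π := fun x hx => ⟨(ha.trans hx.1).le, hx.2.le⟩
  have key : ∀ {f : ℝ → ℂ}, MemLp f 2 (volume.restrict (Icc 0 π)) →
      IsCoef a π ((Ioo a π).indicator f) := fun hf =>
    ⟨(memLp_indicator_iff_restrict measurableSet_Ioo).2
      (hf.mono_measure (Measure.restrict_mono hsub le_rfl)), fun t ht => indicator_of_notMem ht _⟩
  refine ⟨_, _, key (f := fun x => p₁ x + Complex.I * p₂ x) (h₁.add (h₂.const_mul Complex.I)),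
    key (f := fun x => p₁ x - Complex.I * p₂ x) (h₁.sub (h₂.const_mul Complex.I)), ?_⟩
  have hne : ∀ᵐ x : ℝ, x ≠ a := by simp [ae_iff, measure_singleton]
  rw [ae_restrict_iff' measurableSet_Ioo] at hzero ⊢
  filter_upwards [hzero, hne] with x hx hxa hxm
  rcases lt_or_gt_of_ne hxa with h | h
  · rw [hx ⟨hxm.1, h⟩, indicator_of_notMem fun h' => h.not_gt h'.1,
      indicator_of_notMem fun h' => h.not_gt h'.1]
    ext i j
    fin_cases i <;> fin_cases j <;> simp [coefMatrix]
  · have hmem : x ∈ Ioo a π := ⟨h, hxm.2⟩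
    rw [hform x hxm, indicator_of_mem hmem, indicator_of_mem hmem]
    have hI := Complex.I_ne_zero
    ext i j
    fin_cases i <;> fin_cases j <;> simp [coefMatrix] <;> field_simp <;> ring

/-- Combining the rows with weights i, -1 and -i, -1 diagonalizes B, while the symmetric trace-free
form of the potentials makes them purely off-diagonal. -/
lemma dirac_equation_iff (z k p q r s : ℂ) (D Y Y₁ Y₂ : Fin 2 → ℂ) :
    matB *ᵥ D + k • (coefMatrix p q *ᵥ Y₁) + coefMatrix r s *ᵥ Y₂ = z • Y ↔
    D 0 + Complex.I * D 1 = Complex.I * z * (Y 0 + Complex.I * Y 1) -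
        Complex.I * (k * p * (Y₁ 0 - Complex.I * Y₁ 1) + r * (Y₂ 0 - Complex.I * Y₂ 1)) ∧
    D 0 - Complex.I * D 1 = Complex.I * -z * (Y 0 - Complex.I * Y 1) -
        Complex.I * (-(k * q) * (Y₁ 0 + Complex.I * Y₁ 1) + -s * (Y₂ 0 + Complex.I * Y₂ 1)) := by
  have hI : Complex.I ^ 2 = -1 := Complex.I_sq
  have h2I : ∀ w : ℂ, w / (2 * Complex.I) = -(Complex.I * w / 2) := by
    intro w
    have := Complex.I_ne_zero
    field_simp
    linear_combination w * hI
  rw [funext_iff, Fin.forall_fin_two]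
  simp only [matB, coefMatrix, h2I, Pi.add_apply, Pi.smul_apply, smul_eq_mul, Matrix.mulVec,
    dotProduct, Fin.sum_univ_two, Matrix.of_apply, Matrix.cons_val', Matrix.cons_val_zero,
    Matrix.cons_val_one, Matrix.cons_val_fin_one]
  constructor
  · rintro ⟨e₀, e₁⟩
    constructor
    · linear_combination Complex.I * e₀ - e₁ +
        (-z * Y 1 - k * (p + q) / 2 * Y₁ 1 - (r + s) / 2 * Y₂ 1) * hI
    · linear_combination -Complex.I * e₀ - e₁ +
        (-z * Y 1 - k * (p + q) / 2 * Y₁ 1 - (r + s) / 2 * Y₂ 1) * hI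
  · rintro ⟨e₀, e₁⟩
    constructor
    · linear_combination (-Complex.I / 2) * (e₀ - e₁) +
        (D 1 + k * ((p + q) / 2 * Y₁ 0 - Complex.I * (p - q) / 2 * Y₁ 1) +
          ((r + s) / 2 * Y₂ 0 - Complex.I * (r - s) / 2 * Y₂ 1) - z * Y 0) * hI
    · linear_combination -(e₀ + e₁) / 2 +
        (-z * Y 1 - k * (p + q) / 2 * Y₁ 1 - (r + s) / 2 * Y₂ 1) * hI

lemma hasDerivAt_pair {U V : ℝ → ℂ} {u v : ℂ} {x : ℝ} (hU : HasDerivAt U u x)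
    (hV : HasDerivAt V v x) :
    HasDerivAt (fun x => ![(U x + V x) / 2, -(Complex.I * (U x - V x) / 2)])
      ![(u + v) / 2, -(Complex.I * (u - v) / 2)] x := by
  rw [hasDerivAt_pi, Fin.forall_fin_two]
  exact ⟨(hU.add hV).div_const 2, (((hU.sub hV).const_mul Complex.I).div_const 2).neg⟩

section Solutions

variable {a b : ℝ} {P Q : ℝ → Matrix (Fin 2) (Fin 2) ℂ} {m : Fin 2} {z : ℂ} {p r q s : ℝ → ℂ}
  {Y : ℝ → Fin 2 → ℂ}

lemma isSolution_integral_equations (ha : 0 < a) (hb : 0 < b) (hp : IsCoef a π p)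
    (hr : IsCoef b π r) (hq : IsCoef a π q) (hs : IsCoef b π s)
    (hP : ∀ᵐ x ∂(volume.restrict (Ioo 0 π)), P x = coefMatrix (p x) (q x))
    (hQ : ∀ᵐ x ∂(volume.restrict (Ioo 0 π)), Q x = coefMatrix (r x) (s x))
    (hY : IsSolution a b P Q m z Y) : ∀ x ∈ Icc 0 π,
      Y x 0 + Complex.I * Y x 1 = delayStep a b z (Y 0 0 + Complex.I * Y 0 1)
        (fun t => (-1 : ℂ) ^ (m : ℕ) * p t) r (fun t => Y t 0 - Complex.I * Y t 1) x ∧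
      Y x 0 - Complex.I * Y x 1 = delayStep a b (-z) (Y 0 0 - Complex.I * Y 0 1)
        (-fun t => (-1 : ℂ) ^ (m : ℕ) * q t) (-s) (fun t => Y t 0 + Complex.I * Y t 1) x := by
  obtain ⟨hac, heq⟩ := hY
  have hUac : AbsolutelyContinuousOnInterval (fun t => Y t 0 + Complex.I * Y t 1) 0 π :=
    (hac 0).fun_add ((hac 1).const_smul Complex.I)
  have hVac : AbsolutelyContinuousOnInterval (fun t => Y t 0 - Complex.I * Y t 1) 0 π :=
    (hac 0).fun_sub ((hac 1).const_smul Complex.I)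
  have hUc := hUac.continuousOn
  have hVc := hVac.continuousOn
  rw [uIcc_of_le Real.pi_pos.le] at hUc hVc
  have hd : ∀ᵐ x : ℝ, x ∈ Icc 0 π → ∃ D : Fin 2 → ℂ, HasDerivAt Y D x ∧
      matB *ᵥ D + (-1 : ℂ) ^ (m : ℕ) • (coefMatrix (p x) (q x) *ᵥ Y (x - a)) +
        coefMatrix (r x) (s x) *ᵥ Y (x - b) = z • Y x := by
    rw [← ae_restrict_iff' measurableSet_Icc, ← restrict_Ioo_eq_restrict_Icc]
    filter_upwards [heq, hP, hQ] with x h1 h2 h3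
    rwa [← h2, ← h3]
  have hdU := eq_delayStep_of_ae_hasDerivAt (z := z) (hp.const_mul ((-1 : ℂ) ^ (m : ℕ))) hr ha hb
    hUac hVc (by
      filter_upwards [hd] with x hx hxm
      obtain ⟨D, hD, e⟩ := hx hxm
      rw [hasDerivAt_pi] at hD
      exact ((hD 0).add ((hD 1).const_mul Complex.I)).congr_deriv
        ((dirac_equation_iff _ _ _ _ _ _ _ _ _ _).1 e).1)
  have hdV := eq_delayStep_of_ae_hasDerivAt (z := -z) (hq.const_mul ((-1 : ℂ) ^ (m : ℕ))).neg hs.neg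
    ha hb hVac hUc (by
      filter_upwards [hd] with x hx hxm
      obtain ⟨D, hD, e⟩ := hx hxm
      rw [hasDerivAt_pi] at hD
      exact ((hD 0).sub ((hD 1).const_mul Complex.I)).congr_deriv
        ((dirac_equation_iff _ _ _ _ _ _ _ _ _ _).1 e).2)
  exact fun x hx => ⟨hdU x hx, hdV x hx⟩

/-- The third Picard iterate, in the original coordinates. -/
noncomputable def iterSol (a b : ℝ) (z : ℂ) (p r q s : ℝ → ℂ) (x : ℝ) : Fin 2 → ℂ :=
  ![((delayIter a b z (-Complex.I) (- -Complex.I) p r q s 3).1 x +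
      (delayIter a b z (-Complex.I) (- -Complex.I) p r q s 3).2 x) / 2,
    -(Complex.I * ((delayIter a b z (-Complex.I) (- -Complex.I) p r q s 3).1 x -
      (delayIter a b z (-Complex.I) (- -Complex.I) p r q s 3).2 x) / 2)]

lemma iterSol_zero : iterSol a b z p r q s 0 = ![0, -1] := by
  have h1 : (delayIter a b z (-Complex.I) (- -Complex.I) p r q s 3).1 0 = -Complex.I :=
    delayStep_zero ..
  have h2 : (delayIter a b z (-Complex.I) (- -Complex.I) p r q s 3).2 0 = - -Complex.I :=
    delayStep_zero ..
  rw [iterSol, h1, h2]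
  have : -(Complex.I * (-Complex.I - - -Complex.I) / 2) = -1 := by
    linear_combination Complex.I_sq
  rw [this]
  simp

/-- The third iterate is built from the second one, read only on [0, π - a). This lies in [0, 2a) as
3a ≥ π, and there the two iterates agree, so the third reproduces itself. -/
lemma isSolution_iterSol (h3a : π ≤ 3 * a) (hab : a < b) (hp : IsCoef a π p)
    (hr : IsCoef b π r) (hq : IsCoef a π q) (hs : IsCoef b π s)
    (hP : ∀ᵐ x ∂(volume.restrict (Ioo 0 π)), P x = coefMatrix (p x) (q x))
    (hQ : ∀ᵐ x ∂(volume.restrict (Ioo 0 π)), Q x = coefMatrix (r x) (s x)) :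
    IsSolution a b P Q m z (iterSol a b z (fun t => (-1 : ℂ) ^ (m : ℕ) * p t) r
      (fun t => (-1 : ℂ) ^ (m : ℕ) * q t) s) := by
  set k : ℂ := (-1 : ℂ) ^ (m : ℕ) with hk
  have hkp := hp.const_mul k
  have hkq := hq.const_mul k
  have ha : 0 < a := by linarith [Real.pi_pos]
  set W := delayIter a b z (-Complex.I) (- -Complex.I) (fun t => k * p t) r (fun t => k * q t) s
    with hW
  have hcont := continuous_delayIter (z := z) (c := -Complex.I) (d := - -Complex.I) hkp hr hkq hs 2
  have hUac : AbsolutelyContinuousOnInterval (W 3).1 0 π :=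
    absolutelyContinuous_delayStep hkp hr hcont.2
  have hVac : AbsolutelyContinuousOnInterval (W 3).2 0 π :=
    absolutelyContinuous_delayStep hkq.neg hs.neg hcont.1
  have hstab := delayIter_succ_eq (z := z) (c := -Complex.I) (d := - -Complex.I) le_rfl hab.le
    hkp hr hkq hs 2
  have hpV : ∀ (f : ℝ → ℂ) (e : ℝ), a ≤ e → IsCoef e π f → ∀ x,
      f x * (W 2).2 (x - e) = f x * (W 3).2 (x - e) ∧
      f x * (W 2).1 (x - e) = f x * (W 3).1 (x - e) := by
    intro f e he hf x
    by_cases hx : x ∈ Ioo e π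
    · have := hstab (x - e) ⟨by linarith [hx.1], by push_cast; linarith [hx.2]⟩
      exact ⟨by rw [this.2], by rw [this.1]⟩
    · simp [hf.eq_zero x hx]
  refine ⟨Fin.forall_fin_two.2 ⟨?_, ?_⟩, ?_⟩
  · have e : (fun x => iterSol a b z (fun t => k * p t) r (fun t => k * q t) s x 0) =
        fun x => (1 / 2 : ℂ) • ((W 3).1 x + (W 3).2 x) := by
      funext x
      simp only [iterSol, Matrix.cons_val_zero, smul_eq_mul, hW]
      ring
    rw [e]
    exact (hUac.fun_add hVac).const_smul (1 / 2 : ℂ)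
  · have e : (fun x => iterSol a b z (fun t => k * p t) r (fun t => k * q t) s x 1) =
        fun x => (-(Complex.I / 2)) • ((W 3).1 x - (W 3).2 x) := by
      funext x
      simp only [iterSol, Matrix.cons_val_one, Matrix.cons_val_fin_one, smul_eq_mul, hW]
      ring
    rw [e]
    exact (hUac.fun_sub hVac).const_smul (-(Complex.I / 2))
  · have hdU := ae_hasDerivAt_delayStep (z := z) (c := -Complex.I) hkp hr hcont.2
    have hdV := ae_hasDerivAt_delayStep (z := -z) (c := - -Complex.I) hkq.neg hs.neg hcont.1
    filter_upwards [ae_restrict_of_ae hdU, ae_restrict_of_ae hdV, hP, hQ] with x h1 h2 h3 h4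
    have e1 : k * p x * (W 2).2 (x - a) = k * p x * (W 3).2 (x - a) := (hpV _ a le_rfl hkp x).1
    have e2 : r x * (W 2).2 (x - b) = r x * (W 3).2 (x - b) := (hpV r b hab.le hr x).1
    have e3 : k * q x * (W 2).1 (x - a) = k * q x * (W 3).1 (x - a) := (hpV _ a le_rfl hkq x).2
    have e4 : s x * (W 2).1 (x - b) = s x * (W 3).1 (x - b) := (hpV s b hab.le hs x).2
    have h1' : HasDerivAt (W 3).1 (Complex.I * z * (W 3).1 x -
        Complex.I * (k * p x * (W 2).2 (x - a) + r x * (W 2).2 (x - b))) x := h1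
    have h2' : HasDerivAt (W 3).2 (Complex.I * -z * (W 3).2 x -
        Complex.I * (-(k * q x) * (W 2).1 (x - a) + -s x * (W 2).1 (x - b))) x := h2
    rw [neg_mul, neg_mul, e3, e4] at h2'
    rw [e1, e2] at h1'
    refine ⟨_, hasDerivAt_pair h1' h2', ?_⟩
    rw [h3, h4, dirac_equation_iff]
    have hU : ∀ x, iterSol a b z (fun t => k * p t) r (fun t => k * q t) s x 0 +
        Complex.I * iterSol a b z (fun t => k * p t) r (fun t => k * q t) s x 1 = (W 3).1 x := by
      intro x
      simp only [iterSol, Matrix.cons_val_zero, Matrix.cons_val_one, Matrix.cons_val_fin_one]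
      linear_combination (-((W 3).1 x - (W 3).2 x) / 2) * Complex.I_sq
    have hV : ∀ x, iterSol a b z (fun t => k * p t) r (fun t => k * q t) s x 0 -
        Complex.I * iterSol a b z (fun t => k * p t) r (fun t => k * q t) s x 1 = (W 3).2 x := by
      intro x
      simp only [iterSol, Matrix.cons_val_zero, Matrix.cons_val_one, Matrix.cons_val_fin_one]
      linear_combination (((W 3).1 x - (W 3).2 x) / 2) * Complex.I_sq
    simp only [hU, hV, Matrix.cons_val_zero, Matrix.cons_val_one, Matrix.cons_val_fin_one, ← hk]
    generalize (W 3).1 x = u, (W 3).2 x = v, (W 3).1 (x - a) = ua, (W 3).2 (x - a) = va,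
      (W 3).1 (x - b) = ub, (W 3).2 (x - b) = vb
    constructor
    · linear_combination (-(Complex.I * z * u - Complex.I * (k * p x * va + r x * vb) -
        (Complex.I * -z * v - Complex.I * (-(k * q x * ua) + -(s x * ub)))) / 2) * Complex.I_sq
    · linear_combination ((Complex.I * z * u - Complex.I * (k * p x * va + r x * vb) -
        (Complex.I * -z * v - Complex.I * (-(k * q x * ua) + -(s x * ub)))) / 2) * Complex.I_sq

end Solutions

/-! ### Characteristic functions and spectra -/

lemma expTransform_const_mul (c : ℝ) (k : ℂ) (f : ℝ → ℂ) (z : ℂ) :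
    expTransform c (fun t => k * f t) z = k * expTransform c f z := by
  simp only [expTransform, mul_assoc, integral_const_mul]

lemma expTransform_sub {l u c : ℝ} {f g : ℝ → ℂ} (hf : IsCoef l u f) (hg : IsCoef l u g) (z : ℂ) :
    expTransform c (fun t => f t - g t) z = expTransform c f z - expTransform c g z := by
  simp only [expTransform, sub_mul]
  exact integral_sub (hf.mul_continuous (by fun_prop)) (hg.mul_continuous (by fun_prop))

lemma ae_eq_of_expTransform_eq {l u c : ℝ} {f g : ℝ → ℂ} (hf : IsCoef l u f) (hg : IsCoef l u g)
    (hl : 0 ≤ l) (hu : u ≤ 2 * π) (h : ∀ z, expTransform c f z = expTransform c g z) :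
    f =ᵐ[volume] g := by
  have h1 := ae_eq_zero_of_expTransform_eq_zero ((hf.sub hg).mono hl hu) (c := c)
    (fun z => by rw [expTransform_sub hf hg, h z, sub_self])
  filter_upwards [h1] with t ht
  exact sub_eq_zero.1 ht

/-- The deviation of a diagonal component of the fundamental solution at `π` from the case of zero
potentials. -/
noncomputable def deviation (a b : ℝ) (κ : ℂ) (p r q s : ℝ → ℂ) (z : ℂ) : ℂ :=
  expTransform (π + a) (oddKernel a b κ p r q s) z +
    expTransform (π + b) (evenKernel a b κ p r q s) z

section Deviation

variable {a b : ℝ} {κ : ℂ} {p r q s p' r' q' s' : ℝ → ℂ}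

/-- Each term of the odd kernel contains exactly one factor from p, q; each term of the even kernel
contains none or two. -/
lemma deviation_const_mul {k : ℂ} (hk : k ^ 2 = 1) (z : ℂ) :
    deviation a b κ (fun t => k * p t) r (fun t => k * q t) s z =
      k * expTransform (π + a) (oddKernel a b κ p r q s) z +
        expTransform (π + b) (evenKernel a b κ p r q s) z := by
  have h1 : oddKernel a b κ (fun t => k * p t) r (fun t => k * q t) s =
      fun t => k * oddKernel a b κ p r q s t := by
    funext t
    simp only [oddKernel, corr_const_mul_left, corr_const_mul_right]
    ring
  have h2 : evenKernel a b κ (fun t => k * p t) r (fun t => k * q t) s =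
      evenKernel a b κ p r q s := by
    funext t
    simp only [evenKernel, corr_const_mul_left, corr_const_mul_right]
    linear_combination corr a p q (t - b / 2) * hk
  rw [deviation, h1, h2, expTransform_const_mul]

/-- The interval (l/2, π + l/2) is |π + l - 2t| < π, so both transforms have the exponential type π
of the leading sine. -/
lemma IsCoef.eq_zero_of_lt_abs {l : ℝ} {f : ℝ → ℂ} (hf : IsCoef (l / 2) (π + l / 2) f) (t : ℝ)
    (ht : π < |π + l - 2 * t|) : f t = 0 := by
  refine hf.eq_zero t fun h => not_le.2 ht (abs_le.2 ⟨?_, ?_⟩)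
  · linarith [h.2]
  · linarith [h.1]

lemma differentiable_deviation (ha : 0 < a) (hab : a < b) (hp : IsCoef a π p) (hr : IsCoef b π r)
    (hq : IsCoef a π q) (hs : IsCoef b π s) : Differentiable ℂ (deviation a b κ p r q s) := by
  have ho := isCoef_oddKernel (κ := κ) ha (ha.trans hab) hp hr hq hs
  have he := isCoef_evenKernel (κ := κ) ha hab hp hr hq hs
  exact (differentiable_expTransform ho.integrable ho.eq_zero_of_lt_abs).add
    (differentiable_expTransform he.integrable he.eq_zero_of_lt_abs)

lemma tendsto_deviation (ha : 0 < a) (hab : a < b) (hp : IsCoef a π p) (hr : IsCoef b π r)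
    (hq : IsCoef a π q) (hs : IsCoef b π s) :
    Tendsto (fun z : ℂ => ‖deviation a b κ p r q s z‖ * Real.exp (-(π * |z.im|))) (cocompact ℂ)
      (𝓝 0) := by
  have ho := isCoef_oddKernel (κ := κ) ha (ha.trans hab) hp hr hq hs
  have he := isCoef_evenKernel (κ := κ) ha hab hp hr hq hs
  have h1 := (tendsto_expTransform ho.integrable ho.eq_zero_of_lt_abs).add
    (tendsto_expTransform he.integrable he.eq_zero_of_lt_abs)
  rw [add_zero] at h1
  refine squeeze_zero (fun z => by positivity) (fun z => ?_) h1
  rw [← add_mul]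
  gcongr
  exact norm_add_le _ _

lemma tendsto_deviation_neg (ha : 0 < a) (hab : a < b) (hp : IsCoef a π p) (hr : IsCoef b π r)
    (hq : IsCoef a π q) (hs : IsCoef b π s) :
    Tendsto (fun z : ℂ => ‖deviation a b κ p r q s (-z)‖ * Real.exp (-(π * |z.im|)))
      (cocompact ℂ) (𝓝 0) := by
  have h1 := (tendsto_deviation (κ := κ) ha hab hp hr hq hs).comp
    (Homeomorph.neg ℂ).isClosedEmbedding.tendsto_cocompact
  refine h1.congr fun z => ?_
  simp

end Deviation

section Spectrum

variable {a b : ℝ} {P Q : ℝ → Matrix (Fin 2) (Fin 2) ℂ} {p r q s : ℝ → ℂ}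

/-- Coefficient functions in diagonal form for a pair of potentials. -/
structure IsCoefOf (a b : ℝ) (P Q : ℝ → Matrix (Fin 2) (Fin 2) ℂ) (p r q s : ℝ → ℂ) : Prop where
  le_three_mul : π ≤ 3 * a
  lt : a < b
  isCoef_p : IsCoef a π p
  isCoef_r : IsCoef b π r
  isCoef_q : IsCoef a π q
  isCoef_s : IsCoef b π s
  ae_eq_P : ∀ᵐ x ∂(volume.restrict (Ioo 0 π)), P x = coefMatrix (p x) (q x)
  ae_eq_Q : ∀ᵐ x ∂(volume.restrict (Ioo 0 π)), Q x = coefMatrix (r x) (s x)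

namespace IsCoefOf

variable {m j : Fin 2} {z k : ℂ} {Y Z : ℝ → Fin 2 → ℂ}

lemma pos (h : IsCoefOf a b P Q p r q s) : 0 < a := by
  linarith [h.le_three_mul, Real.pi_pos]

lemma isCoef_const_mul_p (h : IsCoefOf a b P Q p r q s) (k : ℂ) :
    IsCoef a π (fun t => k * p t) := h.isCoef_p.const_mul k

lemma isCoef_const_mul_q (h : IsCoefOf a b P Q p r q s) (k : ℂ) :
    IsCoef a π (fun t => k * q t) := h.isCoef_q.const_mul k

/-- Linearity and uniqueness for the integral equations. The case k = 1 identifies the chosen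
`fundSol` with the explicit iterate; general k shows that every solution with y₁(0) = 0 is a
multiple of it. -/
lemma solution_eq_smul (h : IsCoefOf a b P Q p r q s) (hY : IsSolution a b P Q m z Y)
    (hZ : IsSolution a b P Q m z Z) (hk : Y 0 = k • Z 0) : ∀ x ∈ Icc 0 π, Y x = k • Z x := by
  have eY := isSolution_integral_equations h.pos (h.pos.trans h.lt) h.isCoef_p h.isCoef_r
    h.isCoef_q h.isCoef_s h.ae_eq_P h.ae_eq_Q hY
  have eZ := isSolution_integral_equations h.pos (h.pos.trans h.lt) h.isCoef_p h.isCoef_r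
    h.isCoef_q h.isCoef_s h.ae_eq_P h.ae_eq_Q hZ
  have hu : Y 0 0 + Complex.I * Y 0 1 = k * (Z 0 0 + Complex.I * Z 0 1) := by
    simp only [hk, Pi.smul_apply, smul_eq_mul]; ring
  have hv : Y 0 0 - Complex.I * Y 0 1 = k * (Z 0 0 - Complex.I * Z 0 1) := by
    simp only [hk, Pi.smul_apply, smul_eq_mul]; ring
  have key := integral_equations_unique h.pos le_rfl h.lt.le (h.isCoef_const_mul_p _) h.isCoef_r
    (h.isCoef_const_mul_q _) h.isCoef_s (fun x hx => (eY x hx).1) (fun x hx => (eY x hx).2)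
    (U' := fun x => k * (Z x 0 + Complex.I * Z x 1))
    (V' := fun x => k * (Z x 0 - Complex.I * Z x 1))
    (fun x hx => by
      rw [hu, delayStep_const_mul]
      exact congrArg (k * ·) (eZ x hx).1)
    (fun x hx => by
      rw [hv, delayStep_const_mul]
      exact congrArg (k * ·) (eZ x hx).2)
  intro x hx
  obtain ⟨e₁, e₂⟩ := key x hx
  have hI := Complex.I_ne_zero
  rw [funext_iff, Fin.forall_fin_two]
  simp only [Pi.smul_apply, smul_eq_mul]
  constructor
  · linear_combination (e₁ + e₂) / 2
  · refine mul_left_cancel₀ hI ?_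
    linear_combination (e₁ - e₂) / 2

lemma fundSol_spec (h : IsCoefOf a b P Q p r q s) (m : Fin 2) (z : ℂ) :
    IsSolution a b P Q m z (fundSol a b P Q m z) ∧ fundSol a b P Q m z 0 = ![0, -1] := by
  have hex : ∃ Y : ℝ → Fin 2 → ℂ, IsSolution a b P Q m z Y ∧ Y 0 = ![0, -1] :=
    ⟨_, isSolution_iterSol h.le_three_mul h.lt h.isCoef_p h.isCoef_r h.isCoef_q h.isCoef_s
      h.ae_eq_P h.ae_eq_Q, iterSol_zero⟩
  rw [fundSol, dif_pos hex]
  exact hex.choose_spec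

lemma charDelta_eq_iterSol (h : IsCoefOf a b P Q p r q s) (m j : Fin 2) (z : ℂ) :
    charDelta a b P Q m j z = iterSol a b z (fun t => (-1 : ℂ) ^ (m : ℕ) * p t) r
      (fun t => (-1 : ℂ) ^ (m : ℕ) * q t) s π j := by
  have h1 := h.solution_eq_smul (k := 1) (h.fundSol_spec m z).1
    (isSolution_iterSol h.le_three_mul h.lt h.isCoef_p h.isCoef_r h.isCoef_q h.isCoef_s
      h.ae_eq_P h.ae_eq_Q) (by rw [(h.fundSol_spec m z).2, iterSol_zero, one_smul])
    π ⟨Real.pi_pos.le, le_rfl⟩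
  rw [charDelta, h1, one_smul]

lemma isEigenvalue_iff (h : IsCoefOf a b P Q p r q s) :
    IsEigenvalue a b P Q m j z ↔ charDelta a b P Q m j z = 0 := by
  obtain ⟨hsol, h0⟩ := h.fundSol_spec m z
  constructor
  · rintro ⟨Y, hY, ⟨x, hx, hne⟩, hY0, hYj⟩
    have hk : Y 0 = (-Y 0 1) • fundSol a b P Q m z 0 := by
      rw [h0, funext_iff, Fin.forall_fin_two]
      simp [hY0]
    have key := h.solution_eq_smul hY hsol hk
    have hY1 : -Y 0 1 ≠ 0 := fun hc => hne (by rw [key x hx, hc, zero_smul])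
    have hpi := congrFun (key π ⟨Real.pi_pos.le, le_rfl⟩) j
    rw [hYj, Pi.smul_apply, smul_eq_mul] at hpi
    exact (mul_eq_zero.1 hpi.symm).resolve_left hY1
  · intro hz
    refine ⟨_, hsol, ⟨0, ⟨le_rfl, Real.pi_pos.le⟩, ?_⟩, by rw [h0]; rfl, hz⟩
    rw [h0]
    intro hc
    simpa using congrFun hc 1

/-- The deviations of the two diagonal components. -/
lemma iter_eq (h : IsCoefOf a b P Q p r q s) (m : Fin 2) (z : ℂ) :
    (delayIter a b z (-Complex.I) (- -Complex.I) (fun t => (-1 : ℂ) ^ (m : ℕ) * p t) r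
      (fun t => (-1 : ℂ) ^ (m : ℕ) * q t) s 3).1 π = -Complex.I * (Complex.exp (Complex.I * z * π) +
        deviation a b Complex.I (fun t => (-1 : ℂ) ^ (m : ℕ) * p t) r
          (fun t => (-1 : ℂ) ^ (m : ℕ) * q t) s z) ∧
    (delayIter a b z (-Complex.I) (- -Complex.I) (fun t => (-1 : ℂ) ^ (m : ℕ) * p t) r
      (fun t => (-1 : ℂ) ^ (m : ℕ) * q t) s 3).2 π = Complex.I *
        (Complex.exp (-(Complex.I * z * π)) +
        deviation a b (-Complex.I) (fun t => (-1 : ℂ) ^ (m : ℕ) * q t) s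
          (fun t => (-1 : ℂ) ^ (m : ℕ) * p t) r (-z)) := by
  refine ⟨delayIter_three_fst h.pos (h.pos.trans h.lt) z _ (h.isCoef_const_mul_p _) h.isCoef_r
    (h.isCoef_const_mul_q _) h.isCoef_s, ?_⟩
  have h1 := delayIter_three_snd h.pos (h.pos.trans h.lt) z (-Complex.I)
    (h.isCoef_const_mul_p ((-1 : ℂ) ^ (m : ℕ))) h.isCoef_r
    (h.isCoef_const_mul_q ((-1 : ℂ) ^ (m : ℕ))) h.isCoef_s
  rw [h1, neg_neg]
  rfl

lemma charDelta_zero (h : IsCoefOf a b P Q p r q s) (m : Fin 2) (z : ℂ) :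
    charDelta a b P Q m 0 z = Complex.sin (π * (z - (0 : ℝ))) + Complex.I / 2 *
      (deviation a b (-Complex.I) (fun t => (-1 : ℂ) ^ (m : ℕ) * q t) s
          (fun t => (-1 : ℂ) ^ (m : ℕ) * p t) r (-z) -
        deviation a b Complex.I (fun t => (-1 : ℂ) ^ (m : ℕ) * p t) r
          (fun t => (-1 : ℂ) ^ (m : ℕ) * q t) s z) := by
  rw [h.charDelta_eq_iterSol, iterSol, Matrix.cons_val_zero, (h.iter_eq m z).1, (h.iter_eq m z).2,
    Complex.sin]
  rw [show -(π * (z - (0 : ℝ)) : ℂ) * Complex.I = -(Complex.I * z * π) by push_cast; ring,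
    show (π * (z - (0 : ℝ)) : ℂ) * Complex.I = Complex.I * z * π by push_cast; ring]
  ring

/-- The unperturbed value -cos πz is written as a shifted sine so that one uniqueness theorem for
entire functions covers both boundary conditions. -/
lemma charDelta_one (h : IsCoefOf a b P Q p r q s) (m : Fin 2) (z : ℂ) :
    charDelta a b P Q m 1 z = Complex.sin (π * (z - (1 / 2 : ℝ))) + (-1 / 2) *
      (deviation a b (-Complex.I) (fun t => (-1 : ℂ) ^ (m : ℕ) * q t) s
          (fun t => (-1 : ℂ) ^ (m : ℕ) * p t) r (-z) +
        deviation a b Complex.I (fun t => (-1 : ℂ) ^ (m : ℕ) * p t) r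
          (fun t => (-1 : ℂ) ^ (m : ℕ) * q t) s z) := by
  rw [h.charDelta_eq_iterSol, iterSol, Matrix.cons_val_one, Matrix.cons_val_fin_one,
    (h.iter_eq m z).1, (h.iter_eq m z).2]
  rw [show (π * (z - (1 / 2 : ℝ)) : ℂ) = z * π - π / 2 by push_cast; ring,
    Complex.sin_sub_pi_div_two, Complex.cos]
  rw [show -(z * π : ℂ) * Complex.I = -(Complex.I * z * π) by ring,
    show (z * π : ℂ) * Complex.I = Complex.I * z * π by ring]
  generalize Complex.exp (-(Complex.I * z * π)) = e₂, Complex.exp (Complex.I * z * π) = e₁,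
    deviation a b (-Complex.I) _ _ _ _ _ = d₂, deviation a b Complex.I _ _ _ _ _ = d₁
  linear_combination ((e₁ + d₁ + e₂ + d₂) / 2) * Complex.I_sq

lemma tendsto_of_deviation (h : IsCoefOf a b P Q p r q s) (m : Fin 2) {F : ℂ → ℂ} {θ : ℝ}
    (k₁ k₂ : ℂ) (hF : ∀ z, F z = Complex.sin (π * (z - θ)) +
      (k₁ * deviation a b (-Complex.I) (fun t => (-1 : ℂ) ^ (m : ℕ) * q t) s
          (fun t => (-1 : ℂ) ^ (m : ℕ) * p t) r (-z) +
        k₂ * deviation a b Complex.I (fun t => (-1 : ℂ) ^ (m : ℕ) * p t) r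
          (fun t => (-1 : ℂ) ^ (m : ℕ) * q t) s z)) :
    Differentiable ℂ F ∧
    Tendsto (fun z : ℂ => ‖F z - Complex.sin (π * (z - θ))‖ * Real.exp (-(π * |z.im|)))
      (cocompact ℂ) (𝓝 0) := by
  have hp := h.isCoef_const_mul_p ((-1 : ℂ) ^ (m : ℕ))
  have hq := h.isCoef_const_mul_q ((-1 : ℂ) ^ (m : ℕ))
  constructor
  · rw [funext hF]
    have d1 := differentiable_deviation (κ := Complex.I) h.pos h.lt hp h.isCoef_r hq h.isCoef_s
    have d2 := (differentiable_deviation (κ := -Complex.I) h.pos h.lt hq h.isCoef_s hp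
      h.isCoef_r).comp differentiable_neg
    have d3 : Differentiable ℂ fun z : ℂ => Complex.sin (π * (z - θ)) := by fun_prop
    exact d3.add ((d2.const_mul k₁).add (d1.const_mul k₂))
  · have t1 := (tendsto_deviation_neg (κ := -Complex.I) h.pos h.lt hq h.isCoef_s hp
      h.isCoef_r).const_mul ‖k₁‖
    have t2 := (tendsto_deviation (κ := Complex.I) h.pos h.lt hp h.isCoef_r hq
      h.isCoef_s).const_mul ‖k₂‖
    have t3 := t1.add t2
    rw [mul_zero, mul_zero, add_zero] at t3
    refine squeeze_zero (fun z => by positivity) (fun z => ?_) t3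
    rw [hF, add_sub_cancel_left, ← mul_assoc, ← mul_assoc, ← add_mul, ← norm_mul, ← norm_mul]
    gcongr
    exact norm_add_le _ _

lemma sine_type_charDelta (h : IsCoefOf a b P Q p r q s) (m j : Fin 2) :
    Differentiable ℂ (charDelta a b P Q m j) ∧
    Tendsto (fun z : ℂ => ‖charDelta a b P Q m j z -
      Complex.sin (π * (z - ((j : ℕ) / 2 : ℝ)))‖ * Real.exp (-(π * |z.im|)))
      (cocompact ℂ) (𝓝 0) := by
  revert j
  rw [Fin.forall_fin_two]
  constructor
  · refine h.tendsto_of_deviation m (Complex.I / 2) (-Complex.I / 2) fun z => ?_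
    rw [h.charDelta_zero m z, Fin.val_zero, Nat.cast_zero, zero_div]
    ring
  · refine h.tendsto_of_deviation m (-1 / 2) (-1 / 2) fun z => ?_
    rw [h.charDelta_one m z, Fin.val_one, Nat.cast_one]
    ring

lemma spectrumMult_eq (h : IsCoefOf a b P Q p r q s) (m j : Fin 2) (z : ℂ) :
    spectrumMult a b P Q m j z = analyticOrderAt (charDelta a b P Q m j) z := by
  rw [spectrumMult]
  split_ifs with hz
  · rfl
  · rw [h.isEigenvalue_iff] at hz
    exact (((h.sine_type_charDelta m j).1.analyticAt z).analyticOrderAt_eq_zero.2 hz).symm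

end IsCoefOf

/-! ### From spectra back to kernels and coefficients. -/

variable {P' Q' : ℝ → Matrix (Fin 2) (Fin 2) ℂ} {p' r' q' s' : ℝ → ℂ}

lemma charDelta_eq_of_spectrumMult_eq (h : IsCoefOf a b P Q p r q s)
    (h' : IsCoefOf a b P' Q' p' r' q' s') (m j : Fin 2)
    (hspec : ∀ z, spectrumMult a b P Q m j z = spectrumMult a b P' Q' m j z) :
    charDelta a b P Q m j = charDelta a b P' Q' m j :=
  eq_of_analyticOrderAt_eq _ (h.sine_type_charDelta m j).1 (h'.sine_type_charDelta m j).1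
    (h.sine_type_charDelta m j).2 (h'.sine_type_charDelta m j).2 fun z => by
      rw [← h.spectrumMult_eq, ← h'.spectrumMult_eq, hspec]

/-- Half the difference over m isolates the odd kernel and half the sum the even one. Because b ≤ π
both supports lie in (0, 2π), where the transform is injective. -/
lemma kernel_ae_eq {κ : ℂ} (ha : 0 < a) (hab : a < b) (hbpi : b ≤ π) (hp : IsCoef a π p)
    (hr : IsCoef b π r) (hq : IsCoef a π q) (hs : IsCoef b π s) (hp' : IsCoef a π p')
    (hr' : IsCoef b π r') (hq' : IsCoef a π q') (hs' : IsCoef b π s')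
    (h : ∀ (m : Fin 2) (z : ℂ),
      deviation a b κ (fun t => (-1 : ℂ) ^ (m : ℕ) * p t) r
          (fun t => (-1 : ℂ) ^ (m : ℕ) * q t) s z =
        deviation a b κ (fun t => (-1 : ℂ) ^ (m : ℕ) * p' t) r'
          (fun t => (-1 : ℂ) ^ (m : ℕ) * q' t) s' z) :
    oddKernel a b κ p r q s =ᵐ[volume] oddKernel a b κ p' r' q' s' ∧
    evenKernel a b κ p r q s =ᵐ[volume] evenKernel a b κ p' r' q' s' := by
  have hsq : ∀ m : Fin 2, ((-1 : ℂ) ^ (m : ℕ)) ^ 2 = 1 := fun m => by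
    rw [← pow_mul, mul_comm, pow_mul]; simp
  have h0 := h 0
  have h1 := h 1
  simp only [deviation_const_mul (hsq _)] at h0 h1
  simp only [Fin.val_zero, pow_zero, one_mul] at h0
  simp only [Fin.val_one, pow_one, neg_one_mul] at h1
  constructor
  · refine ae_eq_of_expTransform_eq (c := π + a)
      (isCoef_oddKernel ha (ha.trans hab) hp hr hq hs)
      (isCoef_oddKernel ha (ha.trans hab) hp' hr' hq' hs') (by linarith) (by linarith)
      fun z => ?_
    linear_combination (h0 z - h1 z) / 2
  · refine ae_eq_of_expTransform_eq (c := π + b) (isCoef_evenKernel ha hab hp hr hq hs)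
      (isCoef_evenKernel ha hab hp' hr' hq' hs') (by linarith) (by linarith)
      fun z => ?_
    linear_combination (h0 z + h1 z) / 2

theorem coef_ae_eq_of_spectrumMult_eq (h : IsCoefOf a b P Q p r q s)
    (h' : IsCoefOf a b P' Q' p' r' q' s') (ha : a < 2 * π / 5) (hb : b ≤ π)
    (hab : π ≤ 2 * a + b / 2)
    (hspec : ∀ (m j : Fin 2) (z : ℂ),
      spectrumMult a b P Q m j z = spectrumMult a b P' Q' m j z) :
    p =ᵐ[volume] p' ∧ r =ᵐ[volume] r' ∧ q =ᵐ[volume] q' ∧ s =ᵐ[volume] s' := by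
  have hc : ∀ m j z, charDelta a b P Q m j z = charDelta a b P' Q' m j z := fun m j z =>
    congrFun (charDelta_eq_of_spectrumMult_eq h h' m j (hspec m j)) z
  have h0 : ∀ (m : Fin 2) (z : ℂ), _ := fun m z => hc m 0 z
  have h1 : ∀ (m : Fin 2) (z : ℂ), _ := fun m z => hc m 1 z
  simp only [h.charDelta_zero, h'.charDelta_zero, h.charDelta_one, h'.charDelta_one] at h0 h1
  -- The two boundary conditions give the difference and the sum of the deviations of V and U, so
  -- each is recovered separately; the one of V occurs at -z, whence the reflected argument in `k₂`.
  have k₁ := kernel_ae_eq (κ := Complex.I) h.pos h.lt hb h.isCoef_p h.isCoef_r h.isCoef_q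
    h.isCoef_s h'.isCoef_p h'.isCoef_r h'.isCoef_q h'.isCoef_s fun m z => by
      have e₀ := mul_left_cancel₀ (by simp) (add_left_cancel (h0 m z))
      have e₁ := mul_left_cancel₀ (by norm_num) (add_left_cancel (h1 m z))
      linear_combination (e₁ - e₀) / 2
  have k₂ := kernel_ae_eq (κ := -Complex.I) h.pos h.lt hb h.isCoef_q h.isCoef_s h.isCoef_p
    h.isCoef_r h'.isCoef_q h'.isCoef_s h'.isCoef_p h'.isCoef_r fun m z => by
      have e₀ := mul_left_cancel₀ (by simp) (add_left_cancel (h0 m (-z)))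
      have e₁ := mul_left_cancel₀ (by norm_num) (add_left_cancel (h1 m (-z)))
      simp only [neg_neg] at e₀ e₁
      linear_combination (e₁ + e₀) / 2
  exact coef_ae_eq_of_kernel_ae_eq ha hab Complex.I_ne_zero h.isCoef_p h.isCoef_r h.isCoef_q
    h.isCoef_s h'.isCoef_p h'.isCoef_r h'.isCoef_q h'.isCoef_s k₁.1 k₁.2 k₂.1 k₂.2

end Spectrum

end DiracDelay

theorem theorem3p1 (a₁ a₂ : ℝ)
    (h₁ : π / 3 ≤ a₁) (h₂ : a₁ < 2 * π / 5) (h₃ : 2 * π / 5 < a₂) (h₄ : a₂ < π)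
    (h₅ : π ≤ 2 * a₁ + a₂ / 2)
    (P Q P' Q' : ℝ → Matrix (Fin 2) (Fin 2) ℂ)
    (hP : DiracDelay.IsPotential a₁ P) (hQ : DiracDelay.IsPotential a₂ Q)
    (hP' : DiracDelay.IsPotential a₁ P') (hQ' : DiracDelay.IsPotential a₂ Q')
    (hspec : ∀ (m j : Fin 2) (z : ℂ),
      DiracDelay.spectrumMult a₁ a₂ P Q m j z = DiracDelay.spectrumMult a₁ a₂ P' Q' m j z) :
    (∀ᵐ x ∂(volume.restrict (Ioo a₁ π)), P x = P' x) ∧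
    (∀ᵐ x ∂(volume.restrict (Ioo a₂ π)), Q x = Q' x) := by
  have hpi := Real.pi_pos
  have ha₁ : 0 < a₁ := by linarith
  have ha₂ : 0 < a₂ := by linarith
  obtain ⟨p, q, hp, hq, hPc⟩ := DiracDelay.exists_isCoef_of_isPotential ha₁ hP
  obtain ⟨r, s, hr, hs, hQc⟩ := DiracDelay.exists_isCoef_of_isPotential ha₂ hQ
  obtain ⟨p', q', hp', hq', hPc'⟩ := DiracDelay.exists_isCoef_of_isPotential ha₁ hP'
  obtain ⟨r', s', hr', hs', hQc'⟩ := DiracDelay.exists_isCoef_of_isPotential ha₂ hQ'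
  obtain ⟨ep, er, eq, es⟩ := DiracDelay.coef_ae_eq_of_spectrumMult_eq
    ⟨by linarith, by linarith, hp, hr, hq, hs, hPc, hQc⟩
    ⟨by linarith, by linarith, hp', hr', hq', hs', hPc', hQc'⟩ h₂ h₄.le h₅ hspec
  constructor
  · refine ae_restrict_of_ae_restrict_of_subset (Ioo_subset_Ioo_left ha₁.le) ?_
    filter_upwards [hPc, hPc', ae_restrict_of_ae ep, ae_restrict_of_ae eq] with x e e' e₁ e₂
    rw [e, e', e₁, e₂]
  · refine ae_restrict_of_ae_restrict_of_subset (Ioo_subset_Ioo_left ha₂.le) ?_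
    filter_upwards [hQc, hQc', ae_restrict_of_ae er, ae_restrict_of_ae es] with x e e' e₁ e₂
    rw [e, e', e₁, e₂]
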